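/- Consider the linear-quadratic optimal control problems, parametrized by the initial state $x_0\in\mathbb{R}^n$, of minimizing $\tfrac12 x(t_f)^\top P x(t_f)+\tfrac12\int_{t_0}^{t_f}\big(x^\top Qx+u^\top Ru\big)\,dt$ subject to $\dot x=Ax+Bu$, $x(t_0)=x_0$, the path constraints $g(x,u)=Cx+Du-d\le 0$ on $[t_0,t_f]$ and the terminal constraints $Ex(t_f)\le e$, where $t_0<t_f$, $Q,P\succeq 0$ and $R\succ 0$ are symmetric. The optimality system (Pontryagin) for $(x,u,\lambda,\mu,\nu)$ consists of the state equation, $\dot\lambda=-(Qx+A^\top\lambda+C^\top\mu)$, $Ru+B^\top\lambda+D^\top\mu=0$, $\mu\ge0$, $g\le0$, $\mu_jg_j=0$ for all $j$ (pointwise on the horizon, except at the end points and at a switching time), continuity of $x$ and $\lambda$ on $[t_0,t_f]$, $x(t_0)=x_0$, and $\lambda(t_f)=Px(t_f)+E^\top\nu$ with $\nu\ge 0$, $Ex(t_f)\le e$ and $\nu_j(Ex(t_f)-e)_j=0$ for all $j$. Fix a switching structure with a single switching event: two different sets $S_1\neq S_2$ of path constraints such that the rows of $D$ with index in $S_1\cup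 S_2$ are linearly independent. A solution of the optimality system has this structure with switching time $t_s\in(t_0,t_f)$ if $g_j=0$ for $j\in S_1$ and $\mu_j=0$ for $j\notin S_1$ on $(t_0,t_s)$, the same holds with $S_2$ on $(t_s,t_f)$, and each constraint $i$ whose status changes (that is, $i$ lies in exactly one of $S_1,S_2$) has $\mu_i>0$ on the arc where it is active and $g_i<0$ on the arc where it is inactive. Let $\mathcal R\subset\mathbb{R}^n$ be a critical region, i.e. a set of initial states $x_0$ for each of which the optimality system has a solution with this structure. Then for each $x_0\in\mathcal R$ there is a unique switching time $t_s(x_0)\in(t_0,t_f)$, the same for all solutions of the optimality system with this structure. It is the time at which the multiplier reaches zero: for every such solution and every constraint $i$ whose status changes, $t_s(x_0)$ is the only $t\in(t_0,t_f)$ such that $\mu_i(s)\to 0$ as $s\to t$, $s\ne t$, and $t$ is a limit of times in $(t_0,t_f)$ at which $\mu_i>0$. Moreover, the function $x_0\mapsto t_s(x_0)$ is continuous on the interior of $\mathcal R$. -/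

import Mathlib

open Set Filter Topology
open scoped Matrix

/-- A continuous-time linear-quadratic optimal control problem on `[t0, tf]`, with `n` states, `k`
controls, `m` path constraints and `p` terminal constraints:
minimise `½ x(tf)ᵀ P x(tf) + ½ ∫ (xᵀ Q x + uᵀ R u) dt` subject to `x' = A x + B u`,
`C x + D u ≤ d` along the horizon, `E x(tf) ≤ e`, and `x(t0) = x₀` (the parameter).
A terminal equality is a pair of opposite inequalities. -/
structure LQProblem (n k m p : ℕ) where
  t0 : ℝ
  tf : ℝ
  horizon : t0 < tf
  A : Matrix (Fin n) (Fin n) ℝ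
  B : Matrix (Fin n) (Fin k) ℝ
  Q : Matrix (Fin n) (Fin n) ℝ
  R : Matrix (Fin k) (Fin k) ℝ
  P : Matrix (Fin n) (Fin n) ℝ
  Q_psd : Q.PosSemidef
  R_pd : R.PosDef
  P_psd : P.PosSemidef
  C : Matrix (Fin m) (Fin n) ℝ
  D : Matrix (Fin m) (Fin k) ℝ
  d : Fin m → ℝ
  E : Matrix (Fin p) (Fin n) ℝ
  e : Fin p → ℝ

/-- State, control, costate, path multiplier (functions of time), and terminal multiplier. -/
structure Trajectory (n k m p : ℕ) where
  x : ℝ → Fin n → ℝ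
  u : ℝ → Fin k → ℝ
  lam : ℝ → Fin n → ℝ
  mu : ℝ → Fin m → ℝ
  nu : Fin p → ℝ

namespace LQProblem

variable {n k m p : ℕ}

/-- The path constraint function `g(x(t), u(t)) = C x(t) + D u(t) - d` along a trajectory. -/
def g (pr : LQProblem n k m p) (z : Trajectory n k m p) (t : ℝ) : Fin m → ℝ :=
  pr.C *ᵥ z.x t + pr.D *ᵥ z.u t - pr.d

/-- The conditions of Pontryagin's minimum principle at time `t`, for the Hamiltonian
`H = ½ xᵀ Q x + ½ uᵀ R u + lamᵀ (A x + B u) + muᵀ (C x + D u - d)`: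
`x' = ∇_lam H`, `lam' = -∇_x H`, `∇_u H = 0`, feasibility and complementary slackness. -/
structure PMPAt (pr : LQProblem n k m p) (z : Trajectory n k m p) (t : ℝ) : Prop where
  state : HasDerivAt z.x (pr.A *ᵥ z.x t + pr.B *ᵥ z.u t) t
  costate : HasDerivAt z.lam
    (-(pr.Q *ᵥ z.x t + pr.Aᵀ *ᵥ z.lam t + pr.Cᵀ *ᵥ z.mu t)) t
  stationarity : pr.R *ᵥ z.u t + pr.Bᵀ *ᵥ z.lam t + pr.Dᵀ *ᵥ z.mu t = 0
  feasible : ∀ j, pr.g z t j ≤ 0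
  dual_feasible : ∀ j, 0 ≤ z.mu t j
  slackness : ∀ j, z.mu t j * pr.g z t j = 0

/-- `z` satisfies the optimality system from the initial state `x₀`, with at most one corner, at
time `t`. Continuity of `x` and `lam` on the whole horizon contains the jump conditions
`x(t⁺) = x(t⁻)`, `lam(t⁺) = lam(t⁻)`. The last four fields are the terminal constraints and the
transversality condition. Since the problem is convex, these necessary conditions are also
sufficient for optimality. -/
structure IsExtremal (pr : LQProblem n k m p) (z : Trajectory n k m p)
    (x₀ : Fin n → ℝ) (t : ℝ) : Prop where
  x_cont : ContinuousOn z.x (Icc pr.t0 pr.tf)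
  lam_cont : ContinuousOn z.lam (Icc pr.t0 pr.tf)
  init : z.x pr.t0 = x₀
  pmp : ∀ s ∈ Ioo pr.t0 pr.tf, s ≠ t → pr.PMPAt z s
  terminal : ∀ j, (pr.E *ᵥ z.x pr.tf) j ≤ pr.e j
  nu_nonneg : ∀ j, 0 ≤ z.nu j
  nu_slack : ∀ j, z.nu j * ((pr.E *ᵥ z.x pr.tf) j - pr.e j) = 0
  transversality : z.lam pr.tf = pr.P *ᵥ z.x pr.tf + pr.Eᵀ *ᵥ z.nu

/-- The activity pattern at time `s` on an arc with active set `S` whose complementary arc has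
active set `S'`: constraints in `S` hold with equality, those outside `S` have zero multiplier, and
a constraint whose status differs between the arcs satisfies this strictly (`mu > 0` if it is
active here, `g < 0` if it is inactive here). -/
structure ActivityAt (pr : LQProblem n k m p) (z : Trajectory n k m p)
    (S S' : Finset (Fin m)) (s : ℝ) : Prop where
  active : ∀ j ∈ S, pr.g z s j = 0
  inactive : ∀ j, j ∉ S → z.mu s j = 0
  active_strict : ∀ j ∈ S, j ∉ S' → 0 < z.mu s j
  inactive_strict : ∀ j, j ∉ S → j ∈ S' → pr.g z s j < 0

/-- `z` solves the optimality system from `x₀` with the switching structure `S₁ → S₂` (active set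
`S₁` on the first arc, `S₂` on the second), the single switching event taking place at `t`. -/
structure HasSwitch (pr : LQProblem n k m p) (S₁ S₂ : Finset (Fin m))
    (z : Trajectory n k m p) (x₀ : Fin n → ℝ) (t : ℝ) : Prop where
  mem : t ∈ Ioo pr.t0 pr.tf
  extremal : pr.IsExtremal z x₀ t
  before : ∀ s ∈ Ioo pr.t0 t, pr.ActivityAt z S₁ S₂ s
  after : ∀ s ∈ Ioo t pr.tf, pr.ActivityAt z S₂ S₁ s

/-- `t` is a switching time of the solution of the optimality system from `x₀`. -/
def IsSwitchingTime (pr : LQProblem n k m p) (S₁ S₂ : Finset (Fin m))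
    (x₀ : Fin n → ℝ) (t : ℝ) : Prop :=
  ∃ z, pr.HasSwitch S₁ S₂ z x₀ t

/-- A critical region of the switching structure `S₁ → S₂`: a set of initial states at each of
which the optimality system has a solution with this structure. -/
def IsCriticalRegion (pr : LQProblem n k m p) (S₁ S₂ : Finset (Fin m))
    (𝓡 : Set (Fin n → ℝ)) : Prop :=
  ∀ x₀ ∈ 𝓡, ∃ t, pr.IsSwitchingTime S₁ S₂ x₀ t

/-- The `i`-th multiplier reaches zero at time `t`: it tends to zero there, and `t` is a limit of
times at which it is positive. -/
def MultiplierReachesZero (pr : LQProblem n k m p) (z : Trajectory n k m p) (i : Fin m)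
    (t : ℝ) : Prop :=
  t ∈ closure {s | s ∈ Ioo pr.t0 pr.tf ∧ 0 < z.mu s i} ∧
    Tendsto (fun s => z.mu s i) (𝓝[≠] t) (𝓝 0)

end LQProblem

/-! ### Dissipation estimates, and linear equations forced by a dissipated quantity. -/

section Dissipation

/-! Convexity gives a Lyapunov-type function for two extremals: with `Δ` denoting their difference,
`Δλ · Δx` decreases at rate at least `c ‖Δu‖²`, since `Q ⪰ 0`, `R ≻ 0` and complementary slackness
gives `Δμ · Δg ≥ 0`. It is nonnegative at `tf` by transversality (`IsExtremal.dissipatesOn`,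
`IsExtremal.terminal_nonneg`). Hence any selection of initial costates is a monotone map of the
initial state, and so is locally bounded in the interior of the critical region
(`exists_eventually_norm_le_of_monotone`).

Let the initial states tend to `x₀` with bounded initial costates. The total drop of `Δλ · Δx` then
tends to zero, so `Δu` vanishes in mean square. Independence of the rows of `D` expresses `Δμ`
linearly through `Δλ` and `Δu`, so `(Δx, Δλ)` solves a linear equation forced by `Δu`. Along an
ultrafilter it converges uniformly to an unforced flow. In the limit `Δg` is zero and `Δμ` is an
analytic function `Ψ`, which need not vanish because the costates are not required to be unique
(`exists_multiplier_limit`).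

If the switching times stayed away from `t`, then on some interval the limiting extremal would have
one active set and the approximating ones the other, while on a second interval the active sets
would agree. Take `i` in exactly one of the sets. Either `Δg_i` on the first interval is the fixed
function `±g_i < 0` up to sign, against its zero limit, or `Ψ_i` vanishes on the second interval,
hence everywhere by analyticity, although it equals a positive multiplier on the first
(`false_of_multiplier_limit`). This yields continuity, and uniqueness is the case of a constant
family.

The multiplier characterization is local: at fixed state and costate the pointwise optimality
conditions with multipliers supported in `S₁ ∪ S₂` have at most one solution (`kktSet_unique`). The
one-sided limits at the switch therefore agree, and a multiplier that is zero on one side tends to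
zero from both. -/

theorem antitoneOn_Icc_of_hasDerivAt_off_finset (T : Finset ℝ) {G : ℝ → ℝ} :
    ∀ {a b : ℝ}, ContinuousOn G (Icc a b) →
      (∀ s ∈ Ioo a b, s ∉ T → ∃ G', HasDerivAt G G' s ∧ G' ≤ 0) → AntitoneOn G (Icc a b) := by
  classical
  induction T using Finset.induction_on with
  | empty =>
    intro a b hc hd
    refine antitoneOn_of_deriv_nonpos (convex_Icc a b) hc ?_ ?_
    · rw [interior_Icc]
      intro s hs
      obtain ⟨G', h, -⟩ := hd s hs (by simp)
      exact h.differentiableAt.differentiableWithinAt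
    · rw [interior_Icc]
      intro s hs
      obtain ⟨G', h, h'⟩ := hd s hs (by simp)
      rwa [h.deriv]
  -- An exceptional point inside the interval splits it in two; continuity at `c` glues the two
  -- monotone pieces.
  | insert c T _ ih =>
    intro a b hc hd
    by_cases hcab : c ∈ Icc a b
    · rw [← Icc_union_Icc_eq_Icc hcab.1 hcab.2]
      refine AntitoneOn.union_right (c := c) (ih (hc.mono (Icc_subset_Icc_right hcab.2)) ?_)
        (ih (hc.mono (Icc_subset_Icc_left hcab.1)) ?_) (isGreatest_Icc hcab.1)
        (isLeast_Icc hcab.2)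
      · intro s hs hsT
        exact hd s ⟨hs.1, hs.2.trans_le hcab.2⟩ (by simp [hs.2.ne, hsT])
      · intro s hs hsT
        exact hd s ⟨hcab.1.trans_lt hs.1, hs.2⟩ (by simp [hs.1.ne', hsT])
    · refine ih hc fun s hs hsT => hd s hs ?_
      rw [Finset.mem_insert, not_or]
      exact ⟨fun h => hcab (h ▸ Ioo_subset_Icc_self hs), hsT⟩

variable {V W : Type*} [NormedAddCommGroup V] [NormedSpace ℝ V] [NormedAddCommGroup W]

/-- Along `[a, b]`, off the finite set `T`, the function `F` decreases at rate at least
`c * ‖w‖ ^ 2`. -/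
structure DissipatesOn (F : ℝ → ℝ) (w : ℝ → W) (c a b : ℝ) (T : Finset ℝ) : Prop where
  cont : ContinuousOn F (Icc a b)
  deriv_le : ∀ s ∈ Ioo a b, s ∉ T → ∃ F', HasDerivAt F F' s ∧ F' ≤ -(c * ‖w s‖ ^ 2)

theorem DissipatesOn.antitoneOn {F : ℝ → ℝ} {w : ℝ → W} {c a b : ℝ} {T : Finset ℝ}
    (hF : DissipatesOn F w c a b T) (hc : 0 ≤ c) : AntitoneOn F (Icc a b) := by
  refine antitoneOn_Icc_of_hasDerivAt_off_finset T hF.cont fun s hs hsT => ?_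
  obtain ⟨F', h, h'⟩ := hF.deriv_le s hs hsT
  exact ⟨F', h, h'.trans (by have : 0 ≤ c * ‖w s‖ ^ 2 := by positivity
                             linarith)⟩

variable [NormedSpace ℝ W]

/-- `y` solves `y' = M y + N w` on `[a, b]`, off the finite set `T`. -/
structure SolvesOn (M : V →L[ℝ] V) (N : W →L[ℝ] V) (y : ℝ → V) (w : ℝ → W) (a b : ℝ)
    (T : Finset ℝ) : Prop where
  cont : ContinuousOn y (Icc a b)
  deriv : ∀ s ∈ Ioo a b, s ∉ T → HasDerivAt y (M (y s) + N (w s)) s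

/-- Young's inequality; it trades the linear size of the forcing for the square that is dissipated.
-/
theorem le_add_sq_div {r η : ℝ} (hη : 0 < η) : r ≤ η + r ^ 2 / η := by
  have : r * η ≤ η * η + r ^ 2 := by nlinarith [sq_nonneg (r - η)]
  calc r = r * η / η := by field_simp
    _ ≤ (η * η + r ^ 2) / η := by gcongr
    _ = η + r ^ 2 / η := by field_simp

variable [CompleteSpace V]

theorem continuous_exp_smul (M : V →L[ℝ] V) {r : ℝ → ℝ} (hr : Continuous r) :
    Continuous fun t : ℝ => NormedSpace.exp (r t • M) := by
  let _ : NormedAlgebra ℚ (V →L[ℝ] V) := NormedAlgebra.restrictScalars ℚ ℝ _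
  exact NormedSpace.exp_continuous.comp (hr.smul continuous_const)

theorem continuous_exp_smul_apply (M : V →L[ℝ] V) (a : ℝ) (v : V) :
    Continuous fun t : ℝ => NormedSpace.exp ((t - a) • M) v :=
  (continuous_exp_smul M (by fun_prop)).clm_apply continuous_const

/-- Solutions of a linear equation stay close to the unforced flow when the forcing is controlled
in the mean square by a dissipated quantity. -/
theorem exists_norm_sub_exp_le (M : V →L[ℝ] V) (N : W →L[ℝ] V) {c : ℝ} (hc : 0 < c) (a b : ℝ) :
    ∃ K : ℝ, 0 ≤ K ∧ ∀ (y : ℝ → V) (w : ℝ → W) (F : ℝ → ℝ) (T : Finset ℝ),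
      SolvesOn M N y w a b T → DissipatesOn F w c a b T → ∀ η > 0, ∀ t ∈ Icc a b,
        ‖y t - NormedSpace.exp ((t - a) • M) (y a)‖ ≤ K * (η + (F a - F b) / η) := by
  let _ : NormedAlgebra ℚ (V →L[ℝ] V) := NormedAlgebra.restrictScalars ℚ ℝ _
  obtain ⟨K₁, hK₁⟩ := isCompact_Icc.exists_bound_of_continuousOn (s := Icc a b)
    (continuous_exp_smul M (r := fun t => a - t) (by fun_prop)).continuousOn
  obtain ⟨K₂, hK₂⟩ := isCompact_Icc.exists_bound_of_continuousOn (s := Icc a b)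
    (continuous_exp_smul M (r := fun t => t - a) (by fun_prop)).continuousOn
  set k₁ := |K₁| * ‖N‖
  have hk₁ : 0 ≤ k₁ := by positivity
  refine ⟨|K₂| * (k₁ * (|b - a| + 1 / c)), by positivity, ?_⟩
  intro y w F T hy hF η hη t ht
  -- Variation of constants: pulling back by the flow leaves only the forcing in the derivative.
  set Z : ℝ → V := fun s => NormedSpace.exp ((a - s) • M) (y s) with hZ
  have hZa : Z a = y a := by simp [hZ]
  have hZc : ContinuousOn Z (Icc a b) :=
    (continuous_exp_smul M (r := fun t => a - t) (by fun_prop)).continuousOn.clm_apply hy.cont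
  have hZd : ∀ s ∈ Ioo a b, s ∉ T →
      HasDerivAt Z (NormedSpace.exp ((a - s) • M) (N (w s))) s := by
    intro s hs hsT
    have h1 : HasDerivAt (fun r : ℝ => NormedSpace.exp ((a - r) • M))
        ((-1 : ℝ) • (NormedSpace.exp ((a - s) • M) * M)) s :=
      (hasDerivAt_exp_smul_const M (a - s)).scomp s ((hasDerivAt_id s).const_sub a)
    have h2 := h1.clm_apply (hy.deriv s hs hsT)
    convert h2 using 1
    simp
  have hdrop : F t - F b ≥ 0 := by
    have := hF.antitoneOn hc.le ht ⟨ht.1.trans ht.2, le_rfl⟩ ht.2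
    linarith
  have hdrop' : F a - F t ≥ 0 := by
    have := hF.antitoneOn hc.le ⟨le_rfl, ht.1.trans ht.2⟩ ht ht.1
    linarith
  have key : ‖Z t - Z a‖ ≤ k₁ * (|b - a| + 1 / c) * (η + (F a - F b) / η) := by
    -- A norming functional reduces the bound to a scalar monotonicity statement. No integral of `w`
    -- appears, so `w` needs no measurability.
    obtain ⟨φ, hφ1, hφ2⟩ := exists_dual_vector'' ℝ (Z t - Z a)
    -- The two correction terms absorb the two terms of Young's inequality for `k₁ * ‖w s‖`.
    have hanti : AntitoneOn (fun s => φ (Z s) - k₁ * η * s + k₁ / (c * η) * F s) (Icc a b) := by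
      refine antitoneOn_Icc_of_hasDerivAt_off_finset T ?_ ?_
      · exact ((φ.continuous.comp_continuousOn hZc).sub (by fun_prop)).add
          (continuousOn_const.mul hF.cont)
      · intro s hs hsT
        obtain ⟨F', hF', hle⟩ := hF.deriv_le s hs hsT
        refine ⟨_, ((φ.hasFDerivAt.comp_hasDerivAt s (hZd s hs hsT)).sub
          ((hasDerivAt_id s).const_mul (k₁ * η))).add (hF'.const_mul (k₁ / (c * η))), ?_⟩
        have hb : φ (NormedSpace.exp ((a - s) • M) (N (w s))) ≤ k₁ * ‖w s‖ := by
          calc φ (NormedSpace.exp ((a - s) • M) (N (w s)))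
              ≤ ‖φ (NormedSpace.exp ((a - s) • M) (N (w s)))‖ := Real.le_norm_self _
            _ ≤ 1 * ‖NormedSpace.exp ((a - s) • M) (N (w s))‖ := φ.le_of_opNorm_le hφ1 _
            _ ≤ 1 * (|K₁| * (‖N‖ * ‖w s‖)) := by
                gcongr
                refine (ContinuousLinearMap.le_opNorm _ _).trans ?_
                gcongr
                · exact (hK₁ s (Ioo_subset_Icc_self hs)).trans (le_abs_self _)
                · exact N.le_opNorm _
            _ = k₁ * ‖w s‖ := by ring
        have h1 : k₁ / (c * η) * F' ≤ - (k₁ * (‖w s‖ ^ 2 / η)) := by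
          calc k₁ / (c * η) * F' ≤ k₁ / (c * η) * (-(c * ‖w s‖ ^ 2)) := by gcongr
            _ = _ := by field_simp
        have h2 := mul_le_mul_of_nonneg_left (le_add_sq_div (r := ‖w s‖) hη) hk₁
        linarith
    have h := hanti ⟨le_rfl, ht.1.trans ht.2⟩ ht ht.1
    have h3 : φ (Z t) - φ (Z a) = ‖Z t - Z a‖ := by rw [← map_sub, hφ2]; rfl
    have h4 : k₁ * η * (t - a) ≤ k₁ * η * |b - a| := by
      gcongr
      exact (by linarith [ht.2] : t - a ≤ b - a).trans (le_abs_self _)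
    have h5 : k₁ / (c * η) * (F a - F t) ≤ k₁ / (c * η) * (F a - F b) := by
      gcongr; linarith
    have h6 : 0 ≤ k₁ * |b - a| * ((F a - F b) / η) :=
      mul_nonneg (by positivity) (div_nonneg (by linarith) hη.le)
    have h7 : 0 ≤ k₁ * (1 / c) * η := by positivity
    have h8 : k₁ / (c * η) * (F a - F b) = k₁ * (1 / c) * ((F a - F b) / η) := by field_simp
    simp only at h
    nlinarith
  have hyt : y t - NormedSpace.exp ((t - a) • M) (y a) =
      NormedSpace.exp ((t - a) • M) (Z t - Z a) := by
    have hinv : NormedSpace.exp ((t - a) • M) * NormedSpace.exp ((a - t) • M) = 1 := by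
      rw [← NormedSpace.exp_add_of_commute (((Commute.refl M).smul_left _).smul_right _),
        ← add_smul]
      simp
    rw [map_sub, hZa]
    congr 1
    simp only [hZ]
    rw [← mul_apply_eq_comp, hinv, one_apply_eq_self]
  rw [hyt, mul_assoc]
  refine (ContinuousLinearMap.le_opNorm _ _).trans ?_
  exact mul_le_mul ((hK₂ t ht).trans (le_abs_self _)) key (norm_nonneg _) (abs_nonneg _)

variable {ι : Type*} {l : Filter ι}

/-- In the error bound `K * (η + drop / η)`, first fix a small `η`, then let the drop tend to zero.
-/
theorem tendstoUniformlyOn_exp_of_dissipation (M : V →L[ℝ] V) (N : W →L[ℝ] V) {c : ℝ}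
    (hc : 0 < c) {a b : ℝ} {y : ι → ℝ → V} {w : ι → ℝ → W} {F : ι → ℝ → ℝ} {T : ι → Finset ℝ}
    (hy : ∀ᶠ k in l, SolvesOn M N (y k) (w k) a b (T k))
    (hF : ∀ᶠ k in l, DissipatesOn (F k) (w k) c a b (T k))
    (hdrop : Tendsto (fun k => F k a - F k b) l (𝓝 0)) {v : V}
    (hv : Tendsto (fun k => y k a) l (𝓝 v)) :
    TendstoUniformlyOn y (fun t => NormedSpace.exp ((t - a) • M) v) l (Icc a b) := by
  obtain ⟨K, hK, hest⟩ := exists_norm_sub_exp_le M N hc a b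
  obtain ⟨K₂, hK₂⟩ := isCompact_Icc.exists_bound_of_continuousOn (s := Icc a b)
    (f := fun t : ℝ => NormedSpace.exp ((t - a) • M))
    (continuous_exp_smul M (by fun_prop)).continuousOn
  rw [Metric.tendstoUniformlyOn_iff]
  intro ε hε
  obtain ⟨η, hη, hηε⟩ : ∃ η > 0, K * η < ε / 4 := by
    refine ⟨ε / 4 / (K + 1), by positivity, ?_⟩
    rw [mul_div_assoc', div_lt_iff₀ (by positivity)]
    nlinarith
  have h1 : ∀ᶠ k in l, K * ((F k a - F k b) / η) < ε / 4 := by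
    have : Tendsto (fun k => K * ((F k a - F k b) / η)) l (𝓝 (K * (0 / η))) :=
      (hdrop.div_const η).const_mul K
    exact this.eventually_lt_const (by simp; positivity)
  have h2 : ∀ᶠ k in l, |K₂| * ‖y k a - v‖ < ε / 4 := by
    have : Tendsto (fun k => |K₂| * ‖y k a - v‖) l (𝓝 (|K₂| * ‖v - v‖)) :=
      ((hv.sub_const v).norm).const_mul _
    exact this.eventually_lt_const (by simp; positivity)
  filter_upwards [hy, hF, h1, h2] with k hyk hFk h1k h2k t ht
  have h3 := hest _ _ _ _ hyk hFk η hη t ht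
  have h4 : ‖NormedSpace.exp ((t - a) • M) (y k a) - NormedSpace.exp ((t - a) • M) v‖
      ≤ |K₂| * ‖y k a - v‖ := by
    rw [← map_sub]
    refine (ContinuousLinearMap.le_opNorm _ _).trans ?_
    gcongr
    exact (hK₂ t ht).trans (le_abs_self _)
  rw [dist_comm, dist_eq_norm]
  have h5 := norm_sub_le_norm_sub_add_norm_sub (y k t)
    (NormedSpace.exp ((t - a) • M) (y k a)) (NormedSpace.exp ((t - a) • M) v)
  rw [mul_add] at h3
  linarith

/-- If `H` were nonzero at a point, `w k` would be bounded below in norm on a fixed interval around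
it, forcing `F k` to drop there by a fixed amount. -/
theorem eq_zero_of_dissipation [l.NeBot] (φ : W →L[ℝ] ℝ) {c : ℝ} (hc : 0 < c) {a b p q : ℝ}
    (hap : a ≤ p) (hqb : q ≤ b) {w : ι → ℝ → W} {F : ι → ℝ → ℝ} {T : ι → Finset ℝ}
    (hF : ∀ᶠ k in l, DissipatesOn (F k) (w k) c a b (T k))
    (hdrop : Tendsto (fun k => F k a - F k b) l (𝓝 0)) {h : ι → ℝ → ℝ} {H : ℝ → ℝ}
    (hφ : ∀ᶠ k in l, ∀ s ∈ Ioo p q, s ∉ T k → φ (w k s) = h k s)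
    (hunif : TendstoUniformlyOn h H l (Ioo p q)) (hH : ContinuousOn H (Ioo p q)) :
    ∀ s ∈ Ioo p q, H s = 0 := by
  intro s₀ hs₀
  by_contra hne
  set ρ := |H s₀| / 4 with hρ
  have hρ0 : 0 < ρ := by have := abs_pos.2 hne; positivity
  have hnear : ∀ᶠ s in 𝓝 s₀, s ∈ Ioo p q ∧ 2 * ρ < |H s| :=
    (isOpen_Ioo.eventually_mem hs₀).and
      (((hH.continuousAt (isOpen_Ioo.mem_nhds hs₀)).abs).eventually_const_lt (by
        rw [hρ]; linarith [abs_pos.2 hne]))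
  obtain ⟨δ, hδ, hball⟩ := Metric.eventually_nhds_iff_ball.1 hnear
  have hmem : ∀ s ∈ Icc (s₀ - δ / 2) (s₀ + δ / 2), s ∈ Ioo p q ∧ 2 * ρ < |H s| := by
    intro s hs
    refine hball s ?_
    rw [Metric.mem_ball, Real.dist_eq, abs_lt]
    constructor <;> linarith [hs.1, hs.2]
  set p' := s₀ - δ / 2
  set q' := s₀ + δ / 2
  have hpq' : p' < q' := by simp only [p', q']; linarith
  have hp' := (hmem p' ⟨le_rfl, hpq'.le⟩).1
  have hq' := (hmem q' ⟨hpq'.le, le_rfl⟩).1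
  -- The guaranteed rate of decrease where `|φ (w k s)| ≥ ρ`; the `+ 1` covers `φ = 0`.
  set κ := c * (ρ / (‖φ‖ + 1)) ^ 2 with hκ
  have hκ0 : 0 < κ := by positivity
  have hsmall : ∀ᶠ k in l, F k a - F k b < κ * (q' - p') :=
    hdrop.eventually_lt_const (mul_pos hκ0 (by linarith))
  obtain ⟨k, hFk, hφk, huk, hsk⟩ :=
    (hF.and (hφ.and ((Metric.tendstoUniformlyOn_iff.1 hunif ρ hρ0).and hsmall))).exists
  have hanti := hFk.antitoneOn hc.le
  have hsub : Icc p' q' ⊆ Icc a b := Icc_subset_Icc (hap.trans hp'.1.le) (hq'.2.le.trans hqb)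
  have hanti' : AntitoneOn (fun s => F k s + κ * s) (Icc p' q') := by
    refine antitoneOn_Icc_of_hasDerivAt_off_finset (T k)
      ((hFk.cont.mono hsub).add (by fun_prop)) fun s hs hsT => ?_
    have hs' := hmem s (Ioo_subset_Icc_self hs)
    obtain ⟨F', hF', hle⟩ := hFk.deriv_le s
      ⟨hap.trans_lt hs'.1.1, hs'.1.2.trans_le hqb⟩ hsT
    refine ⟨_, hF'.add ((hasDerivAt_id s).const_mul κ), ?_⟩
    have h1 := huk s hs'.1
    rw [Real.dist_eq] at h1
    have h2 : ρ ≤ |h k s| := by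
      have := abs_sub_abs_le_abs_sub (H s) (h k s)
      linarith [hs'.2]
    have h3 : |h k s| ≤ ‖φ‖ * ‖w k s‖ := by
      rw [← hφk s hs'.1 hsT, ← Real.norm_eq_abs]
      exact φ.le_opNorm _
    have h4 : ρ / (‖φ‖ + 1) ≤ ‖w k s‖ := by
      rw [div_le_iff₀ (by positivity)]
      nlinarith [norm_nonneg (w k s)]
    have h5 : κ ≤ c * ‖w k s‖ ^ 2 := by rw [hκ]; gcongr
    linarith
  have h1 := hanti' ⟨le_rfl, hpq'.le⟩ ⟨hpq'.le, le_rfl⟩ hpq'.le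
  have h2 := hanti ⟨le_rfl, (hsub ⟨le_rfl, hpq'.le⟩).1.trans (hsub ⟨le_rfl, hpq'.le⟩).2⟩
    (hsub ⟨le_rfl, hpq'.le⟩) (hsub ⟨le_rfl, hpq'.le⟩).1
  have h3 := hanti (hsub ⟨hpq'.le, le_rfl⟩)
    ⟨(hsub ⟨le_rfl, hpq'.le⟩).1.trans (hsub ⟨le_rfl, hpq'.le⟩).2, le_rfl⟩
    (hsub ⟨hpq'.le, le_rfl⟩).2
  simp only at h1
  linarith

/-- The identity theorem for real-analytic functions on the line. -/
theorem ContinuousLinearMap.eq_zero_of_eqOn_Ioo_exp (M : V →L[ℝ] V) (ψ : V →L[ℝ] ℝ) (v : V)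
    (a : ℝ) {p q : ℝ} (hpq : p < q)
    (h : ∀ s ∈ Ioo p q, ψ (NormedSpace.exp ((s - a) • M) v) = 0) (s : ℝ) :
    ψ (NormedSpace.exp ((s - a) • M) v) = 0 := by
  have han : AnalyticOnNhd ℝ (fun s : ℝ => ψ (NormedSpace.exp ((s - a) • M) v)) univ := by
    intro s _
    have h1 : AnalyticAt ℝ (fun s : ℝ => (s - a) • M) s :=
      (analyticAt_id.sub analyticAt_const).smul analyticAt_const
    have h2 : AnalyticAt ℝ (fun s : ℝ => NormedSpace.exp ((s - a) • M)) s :=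
      (NormedSpace.exp_analytic (𝕂 := ℝ) ((s - a) • M)).comp_of_eq h1 rfl
    exact (ψ.analyticAt _).comp_of_eq (((ContinuousLinearMap.apply ℝ V v).analyticAt _).comp_of_eq h2 rfl) rfl
  have hmid : (p + q) / 2 ∈ Ioo p q := ⟨by linarith, by linarith⟩
  have := AnalyticOnNhd.eq_of_eventuallyEq han (analyticOnNhd_const (v := (0 : ℝ)))
    (z₀ := (p + q) / 2) (by filter_upwards [isOpen_Ioo.mem_nhds hmid] with s hs using h s hs)
  exact congrFun this s

end Dissipation

/-! ### Local boundedness of monotone maps, and coercivity of positive definite forms. -/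

section Monotone

/-- Testing monotonicity of `T` at `y` against the finitely many points `x ± r eᵢ` bounds `± r * T y
i` by their values plus an error `S * δ`, where `S` is the `ℓ¹` norm of `T y`. Summing over `i`, the
error is absorbed when `y` is close to `x`. -/
theorem exists_eventually_norm_le_of_monotone {n : ℕ} {T : (Fin n → ℝ) → Fin n → ℝ}
    {U : Set (Fin n → ℝ)} {x : Fin n → ℝ} (hU : U ∈ 𝓝 x)
    (hT : ∀ a ∈ U, ∀ b ∈ U, 0 ≤ (T a - T b) ⬝ᵥ (a - b)) :
    ∃ K : ℝ, ∀ᶠ y in 𝓝 x, ‖T y‖ ≤ K := by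
  classical
  obtain ⟨r, hr, hball⟩ := Metric.nhds_basis_closedBall.mem_iff.1 hU
  have hv : ∀ i : Fin n, ∀ σ : ℝ, |σ| ≤ 1 → x + Pi.single i (σ * r) ∈ U := by
    intro i σ hσ
    apply hball
    rw [Metric.mem_closedBall, dist_eq_norm, add_sub_cancel_left, pi_norm_le_iff_of_nonneg hr.le]
    intro j
    by_cases hj : j = i
    · subst hj
      rw [Pi.single_eq_same, Real.norm_eq_abs, abs_mul, abs_of_pos hr]
      nlinarith
    · rw [Pi.single_eq_of_ne hj]; simpa using hr.le
  -- Chosen so that `n * δ ≤ r / 2`, which lets `n * S * δ` be absorbed into `S * r`.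
  set δ := r / (2 * (n + 1)) with hδ
  have hδ0 : 0 < δ := by positivity
  have hδr : δ ≤ r := by rw [hδ]; exact div_le_self hr.le (by have : (0:ℝ) ≤ n := n.cast_nonneg
                                                              linarith)
  -- bound of `T y ⬝ᵥ (v - y)` by the values at the vertices
  set B : Fin n → ℝ → ℝ := fun i σ => (∑ j, |T (x + Pi.single i (σ * r)) j|) * (2 * r) with hB
  set K₀ := ∑ i, (|B i 1| + |B i (-1)|) with hK₀
  have hBK : ∀ i, B i 1 ≤ K₀ ∧ B i (-1) ≤ K₀ := by
    intro i
    have := Finset.single_le_sum (f := fun i => |B i 1| + |B i (-1)|)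
      (fun i _ => by positivity) (Finset.mem_univ i)
    constructor <;> linarith [le_abs_self (B i 1), le_abs_self (B i (-1)), abs_nonneg (B i 1),
      abs_nonneg (B i (-1))]
  refine ⟨2 * (n * K₀) / r, ?_⟩
  filter_upwards [Metric.closedBall_mem_nhds x hδ0] with y hy
  rw [Metric.mem_closedBall, dist_eq_norm] at hy
  have hyU : y ∈ U := hball (by rw [Metric.mem_closedBall, dist_eq_norm]; exact hy.trans hδr)
  have hyj : ∀ j, |y j - x j| ≤ δ := fun j => (norm_le_pi_norm (y - x) j).trans hy
  set S := ∑ j, |T y j| with hS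
  have habs : ∀ (f g : Fin n → ℝ) (ρ : ℝ), (∀ j, |g j| ≤ ρ) → f ⬝ᵥ g ≤ (∑ j, |f j|) * ρ := by
    intro f g ρ hg
    rw [dotProduct, Finset.sum_mul]
    refine Finset.sum_le_sum fun j _ => (le_abs_self _).trans ?_
    rw [abs_mul]
    exact mul_le_mul_of_nonneg_left (hg j) (abs_nonneg _)
  have hone : ∀ i σ, |σ| = 1 → T y i * (σ * r) ≤ B i σ + S * δ := by
    intro i σ hσ
    have hm := hT _ hyU _ (hv i σ hσ.le)
    have e1 : y - (x + Pi.single i (σ * r)) = (y - x) - Pi.single i (σ * r) := by abel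
    rw [sub_dotProduct, e1, dotProduct_sub, dotProduct_single] at hm
    have h1 := habs (T y) (y - x) δ hyj
    have h2 := habs (T (x + Pi.single i (σ * r))) (-((y - x) - Pi.single i (σ * r))) (2 * r) (by
      intro j
      rw [Pi.neg_apply, abs_neg, Pi.sub_apply]
      have h3 : |(Pi.single i (σ * r) : Fin n → ℝ) j| ≤ r := by
        by_cases hj : j = i
        · subst hj
          rw [Pi.single_eq_same, abs_mul, hσ, abs_of_pos hr, one_mul]
        · rw [Pi.single_eq_of_ne hj]; simpa using hr.le
      have := abs_sub (( y - x) j) ((Pi.single i (σ * r) : Fin n → ℝ) j)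
      have h4 : |(y - x) j| ≤ δ := hyj j
      linarith)
    rw [dotProduct_neg] at h2
    simp only [hB]
    linarith
  have hcoord : ∀ i, |T y i| * r ≤ K₀ + S * δ := by
    intro i
    have h1 := hone i 1 (by simp)
    have h2 := hone i (-1) (by simp)
    rcases abs_cases (T y i) with ⟨h, -⟩ | ⟨h, -⟩ <;> rw [h] <;> nlinarith [hBK i]
  have hsum : S * r ≤ n * (K₀ + S * δ) := by
    rw [hS, Finset.sum_mul]
    refine (Finset.sum_le_sum fun i _ => hcoord i).trans ?_
    simp [← hS, mul_add]
  have hS0 : 0 ≤ S := by positivity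
  have hnδ : n * δ ≤ r / 2 := by
    rw [hδ, mul_div_assoc', div_le_div_iff₀ (by positivity) (by norm_num)]
    nlinarith
  have hSle : S ≤ 2 * (n * K₀) / r := by
    rw [le_div_iff₀ hr]
    nlinarith
  rw [pi_norm_le_iff_of_nonneg (hS0.trans hSle)]
  intro j
  exact (Finset.single_le_sum (f := fun j => |T y j|) (fun _ _ => abs_nonneg _)
    (Finset.mem_univ j)).trans hSle

theorem Matrix.PosDef.exists_mul_norm_sq_le {k : ℕ} {R : Matrix (Fin k) (Fin k) ℝ}
    (hR : R.PosDef) : ∃ c > 0, ∀ u : Fin k → ℝ, c * ‖u‖ ^ 2 ≤ u ⬝ᵥ (R *ᵥ u) := by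
  have hcont : Continuous fun u : Fin k → ℝ => u ⬝ᵥ (R *ᵥ u) := by fun_prop
  by_cases hne : (Metric.sphere (0 : Fin k → ℝ) 1).Nonempty
  · obtain ⟨v, hv, hmin⟩ := (isCompact_sphere (0 : Fin k → ℝ) 1).exists_isMinOn hne
      hcont.continuousOn
    have hv0 : v ≠ 0 := by
      rintro rfl
      simp at hv
    refine ⟨v ⬝ᵥ (R *ᵥ v), by simpa using hR.dotProduct_mulVec_pos hv0, fun u => ?_⟩
    by_cases hu : u = 0
    · simp [hu]
    have hun : 0 < ‖u‖ := norm_pos_iff.2 hu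
    have h := hmin (a := ‖u‖⁻¹ • u) (by simp [norm_smul, hun.ne'])
    simp only [mem_ofPred_eq, Matrix.mulVec_smul, dotProduct_smul, smul_dotProduct,
      smul_eq_mul] at h
    calc v ⬝ᵥ (R *ᵥ v) * ‖u‖ ^ 2 ≤ ‖u‖⁻¹ * (‖u‖⁻¹ * u ⬝ᵥ (R *ᵥ u)) * ‖u‖ ^ 2 := by gcongr
      _ = u ⬝ᵥ (R *ᵥ u) := by field_simp
  -- An empty unit sphere means that the space is trivial, so any constant works.
  · refine ⟨1, one_pos, fun u => ?_⟩
    have hu : u = 0 := by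
      by_contra hu
      exact hne ⟨‖u‖⁻¹ • u, by simp [norm_smul, hu]⟩
    simp [hu]

end Monotone

/-! ### Pointwise optimality conditions and the comparison of two extremals. -/

namespace LQProblem

variable {n k m p : ℕ} (pr : LQProblem n k m p)

theorem eq_zero_of_transpose_mulVec_eq_zero {S : Finset (Fin m)}
    (hD : LinearIndependent ℝ (fun i : {i // i ∈ S} => pr.D i.1)) {μ : Fin m → ℝ}
    (hμ : ∀ j, j ∉ S → μ j = 0) (h : pr.Dᵀ *ᵥ μ = 0) : μ = 0 := by
  rw [Matrix.mulVec_transpose, Matrix.vecMul_eq_sum] at h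
  have hsum : ∑ i : {i // i ∈ S}, μ i.1 • pr.D i.1 = 0 := by
    rw [← h, ← Finset.sum_subset (Finset.subset_univ S) (fun j _ hj => by rw [hμ j hj, zero_smul])]
    exact Finset.sum_coe_sort S (fun i => μ i • pr.D i)
  have := Fintype.linearIndependent_iff.1 hD (fun i => μ i.1) hsum
  funext j
  by_cases hj : j ∈ S
  · exact this ⟨j, hj⟩
  · exact hμ j hj

/-- Recovers the multiplier from stationarity by one linear map that works for both arcs. Recording
the coordinates outside `S` next to `Dᵀ μ` makes the map injective on the whole space, so a linear
left inverse exists. -/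
theorem exists_leftInverse_transpose {S : Finset (Fin m)}
    (hD : LinearIndependent ℝ (fun i : {i // i ∈ S} => pr.D i.1)) :
    ∃ L : (Fin k → ℝ) →L[ℝ] (Fin m → ℝ),
      ∀ μ : Fin m → ℝ, (∀ j, j ∉ S → μ j = 0) → L (pr.Dᵀ *ᵥ μ) = μ := by
  let f : (Fin m → ℝ) →ₗ[ℝ] (Fin k → ℝ) × (Fin m → ℝ) :=
    { toFun := fun μ => (pr.Dᵀ *ᵥ μ, fun j => if j ∈ S then 0 else μ j)
      map_add' := fun μ ν => by
        ext j
        · simp [Matrix.mulVec_add]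
        · by_cases hj : j ∈ S <;> simp [hj]
      map_smul' := fun r μ => by
        ext j
        · simp [Matrix.mulVec_smul]
        · by_cases hj : j ∈ S <;> simp [hj] }
  have hf : LinearMap.ker f = ⊥ := by
    rw [LinearMap.ker_eq_bot']
    intro μ hμ
    refine pr.eq_zero_of_transpose_mulVec_eq_zero hD (fun j hj => ?_) (congrArg Prod.fst hμ)
    simpa [f, hj] using congrFun (congrArg Prod.snd hμ) j
  obtain ⟨g, hg⟩ := f.exists_leftInverse_of_injective hf
  refine ⟨LinearMap.toContinuousLinearMap (g ∘ₗ LinearMap.inl ℝ _ _), fun μ hμ => ?_⟩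
  have hfμ : f μ = (pr.Dᵀ *ᵥ μ, 0) := by
    refine Prod.ext rfl (funext fun j => ?_)
    by_cases hj : j ∈ S
    · simp [f, hj]
    · simp [f, hj, hμ j hj]
  have := LinearMap.congr_fun hg μ
  simpa [hfμ] using this

theorem eq_zero_of_dotProduct_mulVec_nonpos {u : Fin k → ℝ} (h : u ⬝ᵥ (pr.R *ᵥ u) ≤ 0) :
    u = 0 := by
  by_contra hu
  have := pr.R_pd.dotProduct_mulVec_pos hu
  rw [star_trivial] at this
  linarith

/-- On an arc with a fixed active set, control and multiplier are continuous functions of state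
and costate. -/
theorem exists_continuous_control_multiplier {U S : Finset (Fin m)} (hSU : S ⊆ U)
    (hD : LinearIndependent ℝ (fun i : {i // i ∈ U} => pr.D i.1)) :
    ∃ Φ : (Fin n → ℝ) × (Fin n → ℝ) → (Fin k → ℝ) × (Fin m → ℝ), Continuous Φ ∧
      ∀ (z : Trajectory n k m p) (S' : Finset (Fin m)) (s : ℝ), pr.PMPAt z s →
        pr.ActivityAt z S S' s → (z.u s, z.mu s) = Φ (z.x s, z.lam s) := by
  -- The linear part of the KKT system of the arc. On its kernel `μ · D u = 0`, so `u` vanishes by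
  -- definiteness of `R`, and then `μ` by independence of the rows of `D`.
  let f : (Fin k → ℝ) × (Fin m → ℝ) →ₗ[ℝ] (Fin k → ℝ) × (Fin m → ℝ) :=
    { toFun := fun w => (pr.R *ᵥ w.1 + pr.Dᵀ *ᵥ w.2,
        fun j => if j ∈ S then (pr.D *ᵥ w.1) j else w.2 j)
      map_add' := fun w v => by
        ext j
        · simp [Matrix.mulVec_add]; ring
        · by_cases hj : j ∈ S <;> simp [hj, Matrix.mulVec_add]
      map_smul' := fun r w => by
        ext j
        · simp [Matrix.mulVec_smul]
        · by_cases hj : j ∈ S <;> simp [hj, Matrix.mulVec_smul] }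
  have hf : LinearMap.ker f = ⊥ := by
    rw [LinearMap.ker_eq_bot']
    rintro ⟨u, μ⟩ hw
    have h1 : pr.R *ᵥ u + pr.Dᵀ *ᵥ μ = 0 := congrArg Prod.fst hw
    have h2 : ∀ j, (if j ∈ S then (pr.D *ᵥ u) j else μ j) = 0 :=
      fun j => congrFun (congrArg Prod.snd hw) j
    have h3 : μ ⬝ᵥ (pr.D *ᵥ u) = 0 := by
      refine Finset.sum_eq_zero fun j _ => ?_
      have := h2 j
      by_cases hj : j ∈ S
      · rw [if_pos hj] at this; rw [this, mul_zero]
      · rw [if_neg hj] at this; rw [this, zero_mul]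
    have h4 : u ⬝ᵥ (pr.R *ᵥ u) + u ⬝ᵥ (pr.Dᵀ *ᵥ μ) = 0 := by
      rw [← dotProduct_add, h1, dotProduct_zero]
    rw [Matrix.mulVec_transpose, dotProduct_comm u (μ ᵥ* pr.D), ← Matrix.dotProduct_mulVec, h3,
      add_zero] at h4
    have hu : u = 0 := pr.eq_zero_of_dotProduct_mulVec_nonpos h4.le
    subst hu
    have hμ : μ = 0 := by
      refine pr.eq_zero_of_transpose_mulVec_eq_zero hD (fun j hj => ?_) (by simpa using h1)
      simpa [show j ∉ S from fun h => hj (hSU h)] using h2 j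
    rw [hμ]; rfl
  obtain ⟨g, hg⟩ := f.exists_leftInverse_of_injective hf
  refine ⟨fun y => g (-(pr.Bᵀ *ᵥ y.2), fun j => if j ∈ S then (pr.d - pr.C *ᵥ y.1) j else 0),
    ?_, ?_⟩
  · refine (LinearMap.continuous_of_finiteDimensional g).comp (Continuous.prodMk (by fun_prop) ?_)
    refine continuous_pi fun j => ?_
    by_cases hj : j ∈ S
    · simp only [hj, if_true]
      exact (continuous_apply j).comp (by fun_prop)
    · simp only [hj, if_false]
      exact continuous_const
  · intro z S' s hz ha
    have h1 := LinearMap.congr_fun hg (z.u s, z.mu s)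
    rw [LinearMap.comp_apply, LinearMap.id_apply] at h1
    rw [← h1]
    congr 1
    refine Prod.ext ?_ (funext fun j => ?_)
    · have := hz.stationarity
      simp only [f, LinearMap.coe_mk, AddHom.coe_mk]
      rw [eq_neg_iff_add_eq_zero, ← this]
      abel
    · by_cases hj : j ∈ S
      · have := ha.active j hj
        simp only [LQProblem.g, Pi.add_apply, Pi.sub_apply] at this
        simp only [f, LinearMap.coe_mk, AddHom.coe_mk, hj, if_true, Pi.sub_apply]
        linarith
      · simp [f, hj, ha.inactive j hj]

/-- Complementarity is a monotone relation: only the cross terms `-μ j * g' j` and `-μ' j * g j`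
survive. It serves path and terminal constraints alike. -/
theorem dotProduct_sub_nonneg_of_slack {μ μ' g g' : Fin m → ℝ} (hg : ∀ j, g j ≤ 0)
    (hg' : ∀ j, g' j ≤ 0) (hμ : ∀ j, 0 ≤ μ j) (hμ' : ∀ j, 0 ≤ μ' j)
    (hs : ∀ j, μ j * g j = 0) (hs' : ∀ j, μ' j * g' j = 0) : 0 ≤ (μ - μ') ⬝ᵥ (g - g') := by
  refine Finset.sum_nonneg fun j _ => ?_
  simp only [Pi.sub_apply]
  nlinarith [hs j, hs' j, mul_nonneg (hμ j) (neg_nonneg.2 (hg' j)),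
    mul_nonneg (hμ' j) (neg_nonneg.2 (hg j))]

/-- The points `((x, lam), (u, mu))` satisfying the pointwise optimality conditions with
multipliers supported in `S`. -/
def kktSet (S : Finset (Fin m)) :
    Set (((Fin n → ℝ) × (Fin n → ℝ)) × ((Fin k → ℝ) × (Fin m → ℝ))) :=
  {y | pr.R *ᵥ y.2.1 + pr.Bᵀ *ᵥ y.1.2 + pr.Dᵀ *ᵥ y.2.2 = 0 ∧
    ∀ j, (pr.C *ᵥ y.1.1 + pr.D *ᵥ y.2.1 - pr.d) j ≤ 0 ∧ 0 ≤ y.2.2 j ∧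
      y.2.2 j * (pr.C *ᵥ y.1.1 + pr.D *ᵥ y.2.1 - pr.d) j = 0 ∧ (j ∉ S → y.2.2 j = 0)}

theorem isClosed_kktSet (S : Finset (Fin m)) : IsClosed (pr.kktSet S) := by
  unfold kktSet
  simp only [ofPred_and, ofPred_forall]
  refine (isClosed_eq (by fun_prop) continuous_const).inter ?_
  refine isClosed_iInter fun j => ?_
  have hg : Continuous fun y : ((Fin n → ℝ) × (Fin n → ℝ)) × ((Fin k → ℝ) × (Fin m → ℝ)) =>
      (pr.C *ᵥ y.1.1 + pr.D *ᵥ y.2.1 - pr.d) j := (continuous_apply j).comp (by fun_prop)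
  have hμ : Continuous fun y : ((Fin n → ℝ) × (Fin n → ℝ)) × ((Fin k → ℝ) × (Fin m → ℝ)) =>
      y.2.2 j := by fun_prop
  refine (isClosed_le hg continuous_const).inter ((isClosed_le continuous_const hμ).inter
    ((isClosed_eq (hμ.mul hg) continuous_const).inter ?_))
  by_cases hj : j ∈ S
  · simp [hj]
  · simpa [hj] using isClosed_eq hμ continuous_const

/-- With equal state and costate, stationarity and monotonicity of complementarity force `Δu · R Δu
≤ 0`; then `Dᵀ Δμ = 0` with `Δμ` supported in `S`. -/
theorem kktSet_unique {S : Finset (Fin m)}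
    (hD : LinearIndependent ℝ (fun i : {i // i ∈ S} => pr.D i.1))
    {y : (Fin n → ℝ) × (Fin n → ℝ)} {w w' : (Fin k → ℝ) × (Fin m → ℝ)}
    (hw : (y, w) ∈ pr.kktSet S) (hw' : (y, w') ∈ pr.kktSet S) : w = w' := by
  obtain ⟨h1, h2⟩ := hw
  obtain ⟨h1', h2'⟩ := hw'
  simp only at h1 h2 h1' h2'
  have hst : pr.R *ᵥ (w.1 - w'.1) + pr.Dᵀ *ᵥ (w.2 - w'.2) = 0 := by
    rw [Matrix.mulVec_sub, Matrix.mulVec_sub, ← sub_self (0 : Fin k → ℝ)]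
    nth_rw 1 [← h1]
    rw [← h1']
    abel
  have hmono := dotProduct_sub_nonneg_of_slack (fun j => (h2 j).1) (fun j => (h2' j).1)
    (fun j => (h2 j).2.1) (fun j => (h2' j).2.1) (fun j => (h2 j).2.2.1) (fun j => (h2' j).2.2.1)
  have e1 : (pr.C *ᵥ y.1 + pr.D *ᵥ w.1 - pr.d) - (pr.C *ᵥ y.1 + pr.D *ᵥ w'.1 - pr.d) =
      pr.D *ᵥ (w.1 - w'.1) := by rw [Matrix.mulVec_sub]; abel
  rw [e1] at hmono
  have h4 : (w.1 - w'.1) ⬝ᵥ (pr.R *ᵥ (w.1 - w'.1)) +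
      (w.1 - w'.1) ⬝ᵥ (pr.Dᵀ *ᵥ (w.2 - w'.2)) = 0 := by
    rw [← dotProduct_add, hst, dotProduct_zero]
  rw [Matrix.mulVec_transpose, dotProduct_comm _ ((w.2 - w'.2) ᵥ* pr.D),
    ← Matrix.dotProduct_mulVec] at h4
  have hu : w.1 - w'.1 = 0 := pr.eq_zero_of_dotProduct_mulVec_nonpos (by linarith)
  rw [hu, Matrix.mulVec_zero, zero_add] at hst
  have hμ : w.2 - w'.2 = 0 := pr.eq_zero_of_transpose_mulVec_eq_zero hD (fun j hj => by
    rw [Pi.sub_apply, (h2 j).2.2.2 hj, (h2' j).2.2.2 hj, sub_zero]) hst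
  exact Prod.ext (sub_eq_zero.1 hu) (sub_eq_zero.1 hμ)

variable {pr}

theorem mem_kktSet {z : Trajectory n k m p} {S S' U : Finset (Fin m)} {s : ℝ} (hSU : S ⊆ U)
    (hz : pr.PMPAt z s) (ha : pr.ActivityAt z S S' s) :
    ((z.x s, z.lam s), (z.u s, z.mu s)) ∈ pr.kktSet U :=
  ⟨hz.stationarity, fun j => ⟨hz.feasible j, hz.dual_feasible j, hz.slackness j,
    fun hj => ha.inactive j fun h => hj (hSU h)⟩⟩

variable {z z' : Trajectory n k m p} {x₀ x₀' : Fin n → ℝ} {t t' : ℝ}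

theorem PMPAt.hasDerivAt_state_sub {s : ℝ} (hz : pr.PMPAt z s) (hz' : pr.PMPAt z' s) :
    HasDerivAt (fun s => z.x s - z'.x s)
      (pr.A *ᵥ (z.x s - z'.x s) + pr.B *ᵥ (z.u s - z'.u s)) s := by
  refine (hz.state.sub hz'.state).congr_deriv ?_
  rw [Matrix.mulVec_sub, Matrix.mulVec_sub]
  abel

theorem PMPAt.hasDerivAt_costate_sub {s : ℝ} (hz : pr.PMPAt z s) (hz' : pr.PMPAt z' s) :
    HasDerivAt (fun s => z.lam s - z'.lam s)
      (-(pr.Q *ᵥ (z.x s - z'.x s) + pr.Aᵀ *ᵥ (z.lam s - z'.lam s) +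
        pr.Cᵀ *ᵥ (z.mu s - z'.mu s))) s := by
  refine (hz.costate.sub hz'.costate).congr_deriv ?_
  rw [Matrix.mulVec_sub, Matrix.mulVec_sub, Matrix.mulVec_sub]
  abel

theorem PMPAt.stationarity_sub {s : ℝ} (hz : pr.PMPAt z s) (hz' : pr.PMPAt z' s) :
    pr.R *ᵥ (z.u s - z'.u s) + pr.Bᵀ *ᵥ (z.lam s - z'.lam s) + pr.Dᵀ *ᵥ (z.mu s - z'.mu s) = 0 := by
  have h := congrArg₂ (· - ·) hz.stationarity hz'.stationarity
  simp only [sub_zero] at h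
  rw [Matrix.mulVec_sub, Matrix.mulVec_sub, Matrix.mulVec_sub, ← h]
  abel

theorem g_sub (pr : LQProblem n k m p) (z z' : Trajectory n k m p) (s : ℝ) :
    pr.g z s - pr.g z' s = pr.C *ᵥ (z.x s - z'.x s) + pr.D *ᵥ (z.u s - z'.u s) := by
  rw [g, g, Matrix.mulVec_sub, Matrix.mulVec_sub]
  abel

theorem transpose_mulVec_dotProduct {a b : ℕ} (M : Matrix (Fin a) (Fin b) ℝ) (v : Fin a → ℝ)
    (w : Fin b → ℝ) : (Mᵀ *ᵥ v) ⬝ᵥ w = v ⬝ᵥ (M *ᵥ w) := by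
  rw [Matrix.mulVec_transpose, Matrix.dotProduct_mulVec]

theorem _root_.HasDerivAt.dotProduct_fin {n : ℕ} {f g : ℝ → Fin n → ℝ} {f' g' : Fin n → ℝ} {s : ℝ}
    (hf : HasDerivAt f f' s) (hg : HasDerivAt g g' s) :
    HasDerivAt (fun s => f s ⬝ᵥ g s) (f' ⬝ᵥ g s + f s ⬝ᵥ g') s := by
  simp only [dotProduct, ← Finset.sum_add_distrib]
  exact HasDerivAt.fun_sum fun i _ => (hasDerivAt_pi.1 hf i).mul (hasDerivAt_pi.1 hg i)

/-- The `A` terms cancel and stationarity replaces the `B` term, so the derivative is `-(Δx · Q Δx +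
Δu · R Δu + Δμ · Δg)`. -/
theorem IsExtremal.dissipatesOn (h : pr.IsExtremal z x₀ t) (h' : pr.IsExtremal z' x₀' t') {c : ℝ}
    (hc : ∀ u : Fin k → ℝ, c * ‖u‖ ^ 2 ≤ u ⬝ᵥ (pr.R *ᵥ u)) :
    DissipatesOn (fun s => (z.lam s - z'.lam s) ⬝ᵥ (z.x s - z'.x s)) (fun s => z.u s - z'.u s) c
      pr.t0 pr.tf {t, t'} where
  cont := by
    have h1 := h.lam_cont.sub h'.lam_cont
    have h2 := h.x_cont.sub h'.x_cont
    simp only [dotProduct]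
    exact continuousOn_finsetSum _ fun i _ =>
      ((continuous_apply i).comp_continuousOn h1).mul ((continuous_apply i).comp_continuousOn h2)
  deriv_le := by
    intro s hs hsT
    simp only [Finset.mem_insert, Finset.mem_singleton, not_or] at hsT
    have hz := h.pmp s hs hsT.1
    have hz' := h'.pmp s hs hsT.2
    refine ⟨_, (hz.hasDerivAt_costate_sub hz').dotProduct_fin (hz.hasDerivAt_state_sub hz'), ?_⟩
    have hst := hz.stationarity_sub hz'
    have hmono := dotProduct_sub_nonneg_of_slack hz.feasible hz'.feasible hz.dual_feasible
      hz'.dual_feasible hz.slackness hz'.slackness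
    rw [g_sub] at hmono
    generalize z.x s - z'.x s = X at *
    generalize z.u s - z'.u s = Y at *
    generalize z.lam s - z'.lam s = Λ at *
    generalize z.mu s - z'.mu s = μ at *
    have hQ := pr.Q_psd.dotProduct_mulVec_nonneg X
    rw [star_trivial] at hQ
    have h1 := congrArg (fun v => v ⬝ᵥ Y) hst
    simp only [add_dotProduct, transpose_mulVec_dotProduct, zero_dotProduct] at h1
    rw [dotProduct_comm] at h1
    rw [neg_dotProduct, add_dotProduct, add_dotProduct, transpose_mulVec_dotProduct,
      transpose_mulVec_dotProduct, dotProduct_add, dotProduct_comm (pr.Q *ᵥ X)]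
    rw [dotProduct_add] at hmono
    linarith [hc Y]

theorem IsExtremal.terminal_nonneg (h : pr.IsExtremal z x₀ t) (h' : pr.IsExtremal z' x₀' t') :
    0 ≤ (z.lam pr.tf - z'.lam pr.tf) ⬝ᵥ (z.x pr.tf - z'.x pr.tf) := by
  have hmono := dotProduct_sub_nonneg_of_slack (g := pr.E *ᵥ z.x pr.tf - pr.e)
    (g' := pr.E *ᵥ z'.x pr.tf - pr.e) (fun j => sub_nonpos.2 (h.terminal j))
    (fun j => sub_nonpos.2 (h'.terminal j)) h.nu_nonneg h'.nu_nonneg h.nu_slack h'.nu_slack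
  have e1 : pr.E *ᵥ z.x pr.tf - pr.e - (pr.E *ᵥ z'.x pr.tf - pr.e) =
      pr.E *ᵥ (z.x pr.tf - z'.x pr.tf) := by rw [Matrix.mulVec_sub]; abel
  have e2 : z.lam pr.tf - z'.lam pr.tf =
      pr.P *ᵥ (z.x pr.tf - z'.x pr.tf) + pr.Eᵀ *ᵥ (z.nu - z'.nu) := by
    rw [h.transversality, h'.transversality, Matrix.mulVec_sub, Matrix.mulVec_sub]; abel
  rw [e1] at hmono
  have hP := pr.P_psd.dotProduct_mulVec_nonneg (z.x pr.tf - z'.x pr.tf)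
  rw [star_trivial] at hP
  rw [e2, add_dotProduct, transpose_mulVec_dotProduct, dotProduct_comm]
  linarith

theorem IsExtremal.monotone_costate (h : pr.IsExtremal z x₀ t) (h' : pr.IsExtremal z' x₀' t') :
    0 ≤ (z.lam pr.t0 - z'.lam pr.t0) ⬝ᵥ (x₀ - x₀') := by
  obtain ⟨c, hc, hcR⟩ := pr.R_pd.exists_mul_norm_sq_le
  have := (h.dissipatesOn h' hcR).antitoneOn hc.le ⟨le_rfl, pr.horizon.le⟩
    ⟨pr.horizon.le, le_rfl⟩ pr.horizon.le
  simp only [h.init, h'.init] at this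
  exact (h.terminal_nonneg h').trans this

end LQProblem

/-! ### Continuity of controls, multipliers and constraints along an arc. -/

namespace LQProblem

variable {n k m p : ℕ} {pr : LQProblem n k m p} {S₁ S₂ : Finset (Fin m)}
  {z z' : Trajectory n k m p} {x₀ x₀' : Fin n → ℝ} {t t' : ℝ}

theorem HasSwitch.pmp_before (h : pr.HasSwitch S₁ S₂ z x₀ t) :
    ∀ s ∈ Ioo pr.t0 t, pr.PMPAt z s := fun s hs =>
  h.extremal.pmp s ⟨hs.1, hs.2.trans h.mem.2⟩ hs.2.ne

theorem HasSwitch.pmp_after (h : pr.HasSwitch S₁ S₂ z x₀ t) :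
    ∀ s ∈ Ioo t pr.tf, pr.PMPAt z s := fun s hs =>
  h.extremal.pmp s ⟨h.mem.1.trans hs.1, hs.2⟩ hs.1.ne'

theorem HasSwitch.inactive_of_notMem_union (h : pr.HasSwitch S₁ S₂ z x₀ t) {s : ℝ}
    (hs : s ∈ Ioo pr.t0 pr.tf) (hst : s ≠ t) (j : Fin m) (hj : j ∉ S₁ ∪ S₂) : z.mu s j = 0 := by
  rw [Finset.mem_union, not_or] at hj
  rcases lt_or_gt_of_ne hst with hlt | hgt
  · exact (h.before s ⟨hs.1, hlt⟩).inactive j hj.1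
  · exact (h.after s ⟨hgt, hs.2⟩).inactive j hj.2

theorem continuousOn_control_multiplier {U S S' : Finset (Fin m)} (hSU : S ⊆ U)
    (hD : LinearIndependent ℝ (fun i : {i // i ∈ U} => pr.D i.1)) {a b : ℝ}
    (hz : ∀ s ∈ Ioo a b, pr.PMPAt z s) (ha : ∀ s ∈ Ioo a b, pr.ActivityAt z S S' s) :
    ContinuousOn (fun s => (z.u s, z.mu s)) (Ioo a b) := by
  obtain ⟨Φ, hΦ, hΦz⟩ := pr.exists_continuous_control_multiplier hSU hD
  have hx : ContinuousOn (fun s => (z.x s, z.lam s)) (Ioo a b) := fun s hs =>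
    ((hz s hs).state.continuousAt.prodMk (hz s hs).costate.continuousAt).continuousWithinAt
  exact (hΦ.comp_continuousOn hx).congr fun s hs => hΦz z S' s (hz s hs) (ha s hs)

theorem continuousOn_multiplier {U S S' : Finset (Fin m)} (hSU : S ⊆ U)
    (hD : LinearIndependent ℝ (fun i : {i // i ∈ U} => pr.D i.1)) {a b : ℝ}
    (hz : ∀ s ∈ Ioo a b, pr.PMPAt z s) (ha : ∀ s ∈ Ioo a b, pr.ActivityAt z S S' s) (i : Fin m) :
    ContinuousOn (fun s => z.mu s i) (Ioo a b) :=
  ((continuous_apply i).comp continuous_snd).comp_continuousOn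
    (continuousOn_control_multiplier hSU hD hz ha)

theorem continuousOn_g {U S S' : Finset (Fin m)} (hSU : S ⊆ U)
    (hD : LinearIndependent ℝ (fun i : {i // i ∈ U} => pr.D i.1)) {a b : ℝ}
    (hz : ∀ s ∈ Ioo a b, pr.PMPAt z s) (ha : ∀ s ∈ Ioo a b, pr.ActivityAt z S S' s) (i : Fin m) :
    ContinuousOn (fun s => pr.g z s i) (Ioo a b) := by
  have hx : ContinuousOn z.x (Ioo a b) := fun s hs =>
    (hz s hs).state.continuousAt.continuousWithinAt
  have hu : ContinuousOn z.u (Ioo a b) :=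
    continuous_fst.comp_continuousOn (continuousOn_control_multiplier hSU hD hz ha)
  have hc : Continuous fun w : (Fin n → ℝ) × (Fin k → ℝ) =>
      pr.C *ᵥ w.1 + pr.D *ᵥ w.2 - pr.d := by fun_prop
  have hg : ContinuousOn (pr.g z) (Ioo a b) :=
    hc.comp_continuousOn (f := fun s => (z.x s, z.u s)) (hx.prodMk hu)
  exact continuousOn_pi.1 hg i

/-! ### The multiplier at the switching time -/

theorem exists_tendsto_kktSet {U S S' : Finset (Fin m)} (hSU : S ⊆ U)
    (hD : LinearIndependent ℝ (fun i : {i // i ∈ U} => pr.D i.1)) {F : Filter ℝ} [F.NeBot]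
    {t : ℝ} (hF : ∀ᶠ s in F, pr.PMPAt z s ∧ pr.ActivityAt z S S' s)
    (hx : Tendsto z.x F (𝓝 (z.x t))) (hlam : Tendsto z.lam F (𝓝 (z.lam t))) :
    ∃ w : (Fin k → ℝ) × (Fin m → ℝ), ((z.x t, z.lam t), w) ∈ pr.kktSet U ∧
      (∀ j, j ∉ S → w.2 j = 0) ∧ ∀ j, Tendsto (fun s => z.mu s j) F (𝓝 (w.2 j)) := by
  obtain ⟨Φ, hΦ, hΦz⟩ := pr.exists_continuous_control_multiplier hSU hD
  have hy : Tendsto (fun s => (z.x s, z.lam s)) F (𝓝 (z.x t, z.lam t)) := hx.prodMk_nhds hlam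
  have hw : Tendsto (fun s => (z.u s, z.mu s)) F (𝓝 (Φ (z.x t, z.lam t))) := by
    refine ((hΦ.tendsto _).comp hy).congr' ?_
    filter_upwards [hF] with s hs using (hΦz z S' s hs.1 hs.2).symm
  have hμ : ∀ j, Tendsto (fun s => z.mu s j) F (𝓝 ((Φ (z.x t, z.lam t)).2 j)) := fun j =>
    (((continuous_apply j).comp continuous_snd).tendsto _).comp hw
  refine ⟨_, (pr.isClosed_kktSet U).mem_of_tendsto (hy.prodMk_nhds hw) ?_, fun j hj => ?_, hμ⟩
  · filter_upwards [hF] with s hs using mem_kktSet hSU hs.1 hs.2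
  · refine tendsto_nhds_unique_of_eventuallyEq (hμ j) tendsto_const_nhds ?_
    filter_upwards [hF] with s hs using hs.2.inactive j hj

/-- The one-sided limits of `(u, mu)` lie in the KKT set over the same state and costate, hence
coincide; on one of the two sides the multiplier of `i` is identically zero. -/
theorem HasSwitch.tendsto_multiplier_zero (h : pr.HasSwitch S₁ S₂ z x₀ t)
    (hD : LinearIndependent ℝ (fun i : {i // i ∈ S₁ ∪ S₂} => pr.D i.1)) {i : Fin m}
    (hi : i ∈ symmDiff S₁ S₂) : Tendsto (fun s => z.mu s i) (𝓝[≠] t) (𝓝 0) := by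
  have hx : ContinuousAt z.x t := h.extremal.x_cont.continuousAt (Icc_mem_nhds h.mem.1 h.mem.2)
  have hl : ContinuousAt z.lam t :=
    h.extremal.lam_cont.continuousAt (Icc_mem_nhds h.mem.1 h.mem.2)
  obtain ⟨w, hwK, hw0, hw⟩ := exists_tendsto_kktSet (z := z) (S := S₁) (S' := S₂) (F := 𝓝[<] t)
    Finset.subset_union_left hD
    (by filter_upwards [Ioo_mem_nhdsLT h.mem.1] with s hs using ⟨h.pmp_before s hs, h.before s hs⟩)
    (hx.mono_left nhdsWithin_le_nhds) (hl.mono_left nhdsWithin_le_nhds)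
  obtain ⟨w', hwK', hw0', hw'⟩ := exists_tendsto_kktSet (z := z) (S := S₂) (S' := S₁)
    (F := 𝓝[>] t) Finset.subset_union_right hD
    (by filter_upwards [Ioo_mem_nhdsGT h.mem.2] with s hs using ⟨h.pmp_after s hs, h.after s hs⟩)
    (hx.mono_left nhdsWithin_le_nhds) (hl.mono_left nhdsWithin_le_nhds)
  obtain rfl := pr.kktSet_unique hD hwK hwK'
  have hi0 : w.2 i = 0 := by
    rcases Finset.mem_symmDiff.1 hi with h | h
    · exact hw0' i h.2
    · exact hw0 i h.2
  rw [← nhdsLT_sup_nhdsGT, ← hi0]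
  exact (hw i).sup (hw' i)

/-- Inside an arc, a positive multiplier is continuous and so violates the limit condition, while an
inactive one is zero nearby and violates the closure condition. -/
theorem not_multiplierReachesZero {U S S' : Finset (Fin m)} (hSU : S ⊆ U)
    (hD : LinearIndependent ℝ (fun i : {i // i ∈ U} => pr.D i.1)) {a b : ℝ}
    (hz : ∀ s ∈ Ioo a b, pr.PMPAt z s) (ha : ∀ s ∈ Ioo a b, pr.ActivityAt z S S' s)
    (ht : t ∈ Ioo a b) {i : Fin m} (hi : i ∈ symmDiff S S') :
    ¬ pr.MultiplierReachesZero z i t := by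
  rintro ⟨hcl, htend⟩
  rcases Finset.mem_symmDiff.1 hi with hi | hi
  · have hpos := (ha t ht).active_strict i hi.1 hi.2
    have hc := (continuousOn_multiplier hSU hD hz ha i).continuousAt (isOpen_Ioo.mem_nhds ht)
    exact hpos.ne' (tendsto_nhds_unique (hc.tendsto.mono_left nhdsWithin_le_nhds) htend)
  · obtain ⟨s, hs, hs'⟩ := mem_closure_iff.1 hcl _ isOpen_Ioo ht
    exact hs'.2.ne' ((ha s hs).inactive i hi.2)

theorem HasSwitch.multiplierReachesZero_iff (h : pr.HasSwitch S₁ S₂ z x₀ t)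
    (hD : LinearIndependent ℝ (fun i : {i // i ∈ S₁ ∪ S₂} => pr.D i.1)) {i : Fin m}
    (hi : i ∈ symmDiff S₁ S₂) {s : ℝ} (hs : s ∈ Ioo pr.t0 pr.tf) :
    pr.MultiplierReachesZero z i s ↔ s = t := by
  constructor
  · intro hr
    by_contra hst
    rcases lt_or_gt_of_ne hst with hlt | hgt
    · exact not_multiplierReachesZero Finset.subset_union_left hD h.pmp_before h.before
        ⟨hs.1, hlt⟩ hi hr
    · exact not_multiplierReachesZero Finset.subset_union_right hD h.pmp_after h.after
        ⟨hgt, hs.2⟩ (symmDiff_comm S₁ S₂ ▸ hi) hr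
  · rintro rfl
    refine ⟨?_, h.tendsto_multiplier_zero hD hi⟩
    rcases Finset.mem_symmDiff.1 hi with hi | hi
    · have hsub : Ioo pr.t0 s ⊆ {r | r ∈ Ioo pr.t0 pr.tf ∧ 0 < z.mu r i} := fun r hr =>
        ⟨⟨hr.1, hr.2.trans hs.2⟩, (h.before r hr).active_strict i hi.1 hi.2⟩
      refine closure_mono hsub ?_
      rw [closure_Ioo hs.1.ne]
      exact right_mem_Icc.2 hs.1.le
    · have hsub : Ioo s pr.tf ⊆ {r | r ∈ Ioo pr.t0 pr.tf ∧ 0 < z.mu r i} := fun r hr =>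
        ⟨⟨hs.1.trans hr.1, hr.2⟩, (h.after r hr).active_strict i hi.1 hi.2⟩
      refine closure_mono hsub ?_
      rw [closure_Ioo hs.2.ne]
      exact left_mem_Icc.2 hs.2.le

/-! ### Stability of the switching time -/

theorem _root_.TendstoUniformlyOn.clm_comp {ι α V W : Type*} [NormedAddCommGroup V]
    [NormedSpace ℝ V] [NormedAddCommGroup W] [NormedSpace ℝ W] {f : ι → α → V} {f₀ : α → V}
    {l : Filter ι} {s : Set α} (hf : TendstoUniformlyOn f f₀ l s) (ψ : V →L[ℝ] W) :
    TendstoUniformlyOn (fun k x => ψ (f k x)) (fun x => ψ (f₀ x)) l s :=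
  ψ.uniformContinuous.comp_tendstoUniformlyOn hf

/-- Multiplication by a matrix as a continuous linear map. -/
noncomputable def mulVecCLM {a b : ℕ} (M : Matrix (Fin a) (Fin b) ℝ) :
    (Fin b → ℝ) →L[ℝ] (Fin a → ℝ) :=
  LinearMap.toContinuousLinearMap M.mulVecLin

@[simp]
theorem mulVecCLM_apply {a b : ℕ} (M : Matrix (Fin a) (Fin b) ℝ) (v : Fin b → ℝ) :
    mulVecCLM M v = M *ᵥ v := rfl

/-- Along solutions with a fixed switching structure whose initial states and initial costates
converge, the difference of the constraint functions tends to zero and the difference of the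
multipliers tends to an analytic function `Ψ`. -/
theorem exists_multiplier_limit {ι : Type*} {l : Filter ι} [l.NeBot]
    (hD : LinearIndependent ℝ (fun i : {i // i ∈ S₁ ∪ S₂} => pr.D i.1))
    (hz : pr.HasSwitch S₁ S₂ z x₀ t) {Z : ι → Trajectory n k m p} {X : ι → Fin n → ℝ}
    {τ : ι → ℝ} (hZ : ∀ᶠ κ in l, pr.HasSwitch S₁ S₂ (Z κ) (X κ) (τ κ))
    (hX : Tendsto X l (𝓝 x₀)) {lam₀ : Fin n → ℝ}
    (hlam : Tendsto (fun κ => (Z κ).lam pr.t0) l (𝓝 lam₀)) :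
    ∃ Ψ : Fin m → ℝ → ℝ,
      (∀ i a b, a < b → (∀ s ∈ Ioo a b, Ψ i s = 0) → ∀ s, Ψ i s = 0) ∧
      (∀ i a b (H : ℝ → ℝ), pr.t0 ≤ a → b ≤ pr.tf → ContinuousOn H (Ioo a b) →
        (∀ᶠ κ in l, ∀ s ∈ Ioo a b, s ≠ t → s ≠ τ κ → pr.g z s i - pr.g (Z κ) s i = H s) →
        ∀ s ∈ Ioo a b, H s = 0) ∧
      (∀ i a b (H : ℝ → ℝ), pr.t0 ≤ a → b ≤ pr.tf → ContinuousOn H (Ioo a b) →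
        (∀ᶠ κ in l, ∀ s ∈ Ioo a b, s ≠ t → s ≠ τ κ → z.mu s i - (Z κ).mu s i = H s) →
        ∀ s ∈ Ioo a b, H s = Ψ i s) := by
  obtain ⟨c, hc, hcR⟩ := pr.R_pd.exists_mul_norm_sq_le
  obtain ⟨L, hL⟩ := pr.exists_leftInverse_transpose hD
  set F : ι → ℝ → ℝ := fun κ s => (z.lam s - (Z κ).lam s) ⬝ᵥ (z.x s - (Z κ).x s) with hFdef
  set w : ι → ℝ → Fin k → ℝ := fun κ s => z.u s - (Z κ).u s with hwdef
  set T : ι → Finset ℝ := fun κ => {t, τ κ} with hT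
  have hF : ∀ᶠ κ in l, DissipatesOn (F κ) (w κ) c pr.t0 pr.tf (T κ) := by
    filter_upwards [hZ] with κ hκ using hz.extremal.dissipatesOn hκ.extremal hcR
  have hx0 : Tendsto (fun κ => z.x pr.t0 - (Z κ).x pr.t0) l (𝓝 0) := by
    have : Tendsto (fun κ => x₀ - X κ) l (𝓝 (x₀ - x₀)) := hX.const_sub x₀
    rw [sub_self] at this
    refine this.congr' ?_
    filter_upwards [hZ] with κ hκ
    rw [hz.extremal.init, hκ.extremal.init]
  have hdrop : Tendsto (fun κ => F κ pr.t0 - F κ pr.tf) l (𝓝 0) := by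
    have h0 : Tendsto (fun κ => F κ pr.t0) l (𝓝 0) := by
      have hcont : Continuous fun y : (Fin n → ℝ) × (Fin n → ℝ) => y.1 ⬝ᵥ y.2 := by fun_prop
      have := (hcont.tendsto (z.lam pr.t0 - lam₀, 0)).comp
        ((hlam.const_sub (z.lam pr.t0)).prodMk_nhds hx0)
      simpa [Function.comp_def, hFdef] using this
    -- The drop lies between `0` and `F κ t0`, because `F κ` is antitone and nonnegative at `tf`.
    refine tendsto_of_tendsto_of_tendsto_of_le_of_le' tendsto_const_nhds h0 ?_ ?_
    · filter_upwards [hF] with κ hκ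
      exact sub_nonneg.2 (hκ.antitoneOn hc.le ⟨le_rfl, pr.horizon.le⟩ ⟨pr.horizon.le, le_rfl⟩
        pr.horizon.le)
    · filter_upwards [hZ] with κ hκ
      exact sub_le_self _ (hz.extremal.terminal_nonneg hκ.extremal)
  have hxlim : TendstoUniformlyOn (fun κ s => z.x s - (Z κ).x s) (fun _ => 0) l
      (Icc pr.t0 pr.tf) := by
    have := tendstoUniformlyOn_exp_of_dissipation (mulVecCLM pr.A) (mulVecCLM pr.B) hc
      (y := fun κ s => z.x s - (Z κ).x s) (T := T) ?_ hF hdrop hx0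
    · simpa using this
    · filter_upwards [hZ] with κ hκ
      refine ⟨hz.extremal.x_cont.sub hκ.extremal.x_cont, fun s hs hsT => ?_⟩
      simp only [hT, Finset.mem_insert, Finset.mem_singleton, not_or] at hsT
      exact (hz.extremal.pmp s hs hsT.1).hasDerivAt_state_sub (hκ.extremal.pmp s hs hsT.2)
  have hmu : ∀ᶠ κ in l, ∀ s ∈ Ioo pr.t0 pr.tf, s ≠ t → s ≠ τ κ → z.mu s - (Z κ).mu s =
      -L (pr.Bᵀ *ᵥ (z.lam s - (Z κ).lam s) + pr.R *ᵥ (z.u s - (Z κ).u s)) := by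
    filter_upwards [hZ] with κ hκ s hs hst hsτ
    have h1 := (hz.extremal.pmp s hs hst).stationarity_sub (hκ.extremal.pmp s hs hsτ)
    have h2 := hL (z.mu s - (Z κ).mu s) fun j hj => by
      rw [Pi.sub_apply, hz.inactive_of_notMem_union hs hst j hj,
        hκ.inactive_of_notMem_union hs hsτ j hj, sub_zero]
    rw [← h2, ← map_neg]
    congr 1
    rw [eq_neg_iff_add_eq_zero, ← h1]
    abel
  -- `M` and `N` come from the state-costate equations after eliminating `Δμ` through `L`. Since `L`
  -- does not depend on the active set, the same equation holds on both arcs and across both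
  -- switches.
  let M : (Fin n → ℝ) × (Fin n → ℝ) →L[ℝ] (Fin n → ℝ) × (Fin n → ℝ) :=
    (mulVecCLM pr.A ∘L .fst ℝ _ _).prod
      (-(mulVecCLM pr.Q ∘L .fst ℝ _ _ + mulVecCLM pr.Aᵀ ∘L .snd ℝ _ _ -
        mulVecCLM pr.Cᵀ ∘L L ∘L mulVecCLM pr.Bᵀ ∘L .snd ℝ _ _))
  let N : (Fin k → ℝ) →L[ℝ] (Fin n → ℝ) × (Fin n → ℝ) :=
    (mulVecCLM pr.B).prod (mulVecCLM pr.Cᵀ ∘L L ∘L mulVecCLM pr.R)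
  have hylim := tendstoUniformlyOn_exp_of_dissipation M N hc
    (y := fun κ s => (z.x s - (Z κ).x s, z.lam s - (Z κ).lam s)) (T := T)
    (v := (0, z.lam pr.t0 - lam₀)) (by
      filter_upwards [hZ, hmu] with κ hκ hμκ
      refine ⟨(hz.extremal.x_cont.sub hκ.extremal.x_cont).prodMk
        (hz.extremal.lam_cont.sub hκ.extremal.lam_cont), fun s hs hsT => ?_⟩
      simp only [hT, Finset.mem_insert, Finset.mem_singleton, not_or] at hsT
      have hp := hz.extremal.pmp s hs hsT.1
      have hp' := hκ.extremal.pmp s hs hsT.2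
      refine ((hp.hasDerivAt_state_sub hp').prodMk (hp.hasDerivAt_costate_sub hp')).congr_deriv ?_
      rw [hμκ s hs hsT.1 hsT.2]
      refine Prod.ext rfl ?_
      simp only [M, N, Prod.snd_add, ContinuousLinearMap.prod_apply, neg_apply, add_apply,
        sub_apply, ContinuousLinearMap.comp_apply, ContinuousLinearMap.coe_fst', hwdef,
        ContinuousLinearMap.coe_snd', mulVecCLM_apply, map_add, Matrix.mulVec_neg,
        Matrix.mulVec_add]
      abel) hF hdrop (hx0.prodMk_nhds (hlam.const_sub _))
  let ψ : Fin m → (Fin n → ℝ) × (Fin n → ℝ) →L[ℝ] ℝ := fun i =>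
    -(.proj i ∘L L ∘L mulVecCLM pr.Bᵀ ∘L .snd ℝ _ _)
  have hcontY : Continuous fun s : ℝ => NormedSpace.exp ((s - pr.t0) • M)
      ((0, z.lam pr.t0 - lam₀) : (Fin n → ℝ) × (Fin n → ℝ)) := continuous_exp_smul_apply M _ _
  refine ⟨fun i s => ψ i (NormedSpace.exp ((s - pr.t0) • M) (0, z.lam pr.t0 - lam₀)),
    fun i a b hab h => ContinuousLinearMap.eq_zero_of_eqOn_Ioo_exp M (ψ i) _ _ hab h, ?_, ?_⟩
  · intro i a b H hta hbt hH hev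
    refine eq_zero_of_dissipation (.proj i ∘L mulVecCLM pr.D) hc hta hbt hF hdrop
      (h := fun κ s => H s - (pr.C *ᵥ (z.x s - (Z κ).x s)) i) ?_ ?_ hH
    · filter_upwards [hev] with κ hκ s hs hsT
      simp only [hT, Finset.mem_insert, Finset.mem_singleton, not_or] at hsT
      rw [← hκ s hs hsT.1 hsT.2, ← Pi.sub_apply, g_sub]
      simp [hwdef]
    · have h1 := (hxlim.mono (Ioo_subset_Icc_self.trans (Icc_subset_Icc hta hbt))).clm_comp
        ((.proj i : (Fin m → ℝ) →L[ℝ] ℝ) ∘L mulVecCLM pr.C)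
      rw [Metric.tendstoUniformlyOn_iff] at h1 ⊢
      intro ε hε
      filter_upwards [h1 ε hε] with κ hκ s hs
      have := hκ s hs
      simpa [Real.dist_eq] using this
  · intro i a b H hta hbt hH hev
    have hsub : Ioo a b ⊆ Ioo pr.t0 pr.tf := Ioo_subset_Ioo hta hbt
    have key := eq_zero_of_dissipation (-(.proj i ∘L L ∘L mulVecCLM pr.R)) hc hta hbt hF hdrop
      (h := fun κ s => H s - ψ i (z.x s - (Z κ).x s, z.lam s - (Z κ).lam s))
      (H := fun s => H s - ψ i (NormedSpace.exp ((s - pr.t0) • M) (0, z.lam pr.t0 - lam₀)))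
      ?_ ?_ (hH.sub ((ψ i).continuous.comp hcontY).continuousOn)
    · exact fun s hs => sub_eq_zero.1 (key s hs)
    · filter_upwards [hev, hmu] with κ hκ hμκ s hs hsT
      simp only [hT, Finset.mem_insert, Finset.mem_singleton, not_or] at hsT
      rw [← hκ s hs hsT.1 hsT.2, ← Pi.sub_apply, hμκ s (hsub hs) hsT.1 hsT.2]
      simp [ψ, hwdef]
    · have h1 := (hylim.mono (Ioo_subset_Icc_self.trans (Icc_subset_Icc hta hbt))).clm_comp (ψ i)
      rw [Metric.tendstoUniformlyOn_iff] at h1 ⊢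
      intro ε hε
      filter_upwards [h1 ε hε] with κ hκ s hs
      have := hκ s hs
      rwa [Real.dist_eq, sub_sub_sub_cancel_left, abs_sub_comm, ← Real.dist_eq]

/-- On `(a, b)` the patterns disagree and on `(a', b')` they agree. A constraint active only for `z`
on `(a, b)` contradicts analyticity of the multiplier limit; one active only for `Z κ` there
contradicts the zero limit of the constraint differences. -/
theorem false_of_multiplier_limit {ι : Type*} {l : Filter ι} [l.NeBot]
    {S S' U : Finset (Fin m)} (hSU : S ⊆ U) (hSS' : S ≠ S')
    (hD : LinearIndependent ℝ (fun i : {i // i ∈ U} => pr.D i.1))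
    {Z : ι → Trajectory n k m p} {τ : ι → ℝ} {Ψ : Fin m → ℝ → ℝ}
    (hΨ : ∀ i a b, a < b → (∀ s ∈ Ioo a b, Ψ i s = 0) → ∀ s, Ψ i s = 0)
    (hg : ∀ i a b (H : ℝ → ℝ), pr.t0 ≤ a → b ≤ pr.tf → ContinuousOn H (Ioo a b) →
        (∀ᶠ κ in l, ∀ s ∈ Ioo a b, s ≠ t → s ≠ τ κ → pr.g z s i - pr.g (Z κ) s i = H s) →
        ∀ s ∈ Ioo a b, H s = 0)
    (hμ : ∀ i a b (H : ℝ → ℝ), pr.t0 ≤ a → b ≤ pr.tf → ContinuousOn H (Ioo a b) →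
        (∀ᶠ κ in l, ∀ s ∈ Ioo a b, s ≠ t → s ≠ τ κ → z.mu s i - (Z κ).mu s i = H s) →
        ∀ s ∈ Ioo a b, H s = Ψ i s)
    {a b a' b' : ℝ} (hta : pr.t0 ≤ a) (hab : a < b) (hbt : b ≤ pr.tf) (hta' : pr.t0 ≤ a')
    (hab' : a' < b') (hbt' : b' ≤ pr.tf)
    (hz : ∀ s ∈ Ioo a b, pr.PMPAt z s ∧ pr.ActivityAt z S S' s)
    (hZ : ∀ᶠ κ in l, ∀ s ∈ Ioo a b, pr.ActivityAt (Z κ) S' S s)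
    (hz' : ∀ s ∈ Ioo a' b', pr.ActivityAt z S' S s)
    (hZ' : ∀ᶠ κ in l, ∀ s ∈ Ioo a' b', pr.ActivityAt (Z κ) S' S s) : False := by
  have hmid : (a + b) / 2 ∈ Ioo a b := ⟨by linarith, by linarith⟩
  have hi : ∃ i, i ∈ symmDiff S S' := by
    by_contra! hne
    exact hSS' (symmDiff_eq_bot.1 (Finset.eq_empty_of_forall_notMem hne))
  obtain ⟨i, hi⟩ := hi
  rcases Finset.mem_symmDiff.1 hi with ⟨hiS, hiS'⟩ | ⟨hiS', hiS⟩
  · have h1 : ∀ s ∈ Ioo a' b', Ψ i s = 0 := fun s hs =>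
      (hμ i a' b' (fun _ => 0) hta' hbt' continuousOn_const (by
        filter_upwards [hZ'] with κ hκ s hs _ _
        rw [(hz' s hs).inactive i hiS', (hκ s hs).inactive i hiS', sub_zero]) s hs).symm
    have h2 := hμ i a b (fun s => z.mu s i) hta hbt
      (continuousOn_multiplier hSU hD (fun s hs => (hz s hs).1) (fun s hs => (hz s hs).2) i) (by
        filter_upwards [hZ] with κ hκ s hs _ _
        rw [(hκ s hs).inactive i hiS', sub_zero]) _ hmid
    rw [hΨ i a' b' hab' h1] at h2
    exact ((hz _ hmid).2.active_strict i hiS hiS').ne' h2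
  · have h2 := hg i a b (fun s => pr.g z s i) hta hbt
      (continuousOn_g hSU hD (fun s hs => (hz s hs).1) (fun s hs => (hz s hs).2) i) (by
        filter_upwards [hZ] with κ hκ s hs _ _
        rw [(hκ s hs).active i hiS', sub_zero]) _ hmid
    exact ((hz _ hmid).2.inactive_strict i hiS hiS').ne h2

theorem HasSwitch.tendsto_switchingTime {ι : Type*} {l : Filter ι} (hS : S₁ ≠ S₂)
    (hD : LinearIndependent ℝ (fun i : {i // i ∈ S₁ ∪ S₂} => pr.D i.1))
    (hz : pr.HasSwitch S₁ S₂ z x₀ t) {Z : ι → Trajectory n k m p} {X : ι → Fin n → ℝ}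
    {τ : ι → ℝ} (hZ : ∀ᶠ κ in l, pr.HasSwitch S₁ S₂ (Z κ) (X κ) (τ κ))
    (hX : Tendsto X l (𝓝 x₀)) {K : ℝ} (hK : ∀ᶠ κ in l, ‖(Z κ).lam pr.t0‖ ≤ K) :
    Tendsto τ l (𝓝 t) := by
  -- Along an ultrafilter the bounded initial costates converge, and failure of an eventual bound on
  -- `τ` becomes an eventual opposite bound.
  rw [tendsto_iff_ultrafilter]
  intro f hf
  have hZf := hf hZ
  obtain ⟨lam₀, -, hlam⟩ := (isCompact_closedBall (0 : Fin n → ℝ) K).ultrafilter_le_nhds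
    (f.map fun κ => (Z κ).lam pr.t0) (by
      rw [le_principal_iff]
      have hKf : ∀ᶠ κ in (f : Filter ι), ‖(Z κ).lam pr.t0‖ ≤ K := hf hK
      rw [Ultrafilter.coe_map, mem_map]
      filter_upwards [hKf] with κ hκ
      simpa using hκ)
  obtain ⟨Ψ, hΨ, hg, hμ⟩ := exists_multiplier_limit (l := (f : Filter ι)) hD hz hZf
    (hX.mono_left hf) hlam
  rw [tendsto_order]
  constructor
  · intro b hb
    by_contra hev
    rw [← Ultrafilter.eventually_not] at hev
    have hb' : max b pr.t0 < t := max_lt hb hz.mem.1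
    refine false_of_multiplier_limit Finset.subset_union_left hS hD hΨ hg hμ
      (a := max b pr.t0) (b := t) (a' := t) (b' := pr.tf) (le_max_right _ _) hb' hz.mem.2.le
      hz.mem.1.le hz.mem.2 le_rfl ?_ ?_ hz.after ?_
    · intro s hs
      have hs' : s ∈ Ioo pr.t0 t := ⟨(le_max_right _ _).trans_lt hs.1, hs.2⟩
      exact ⟨hz.pmp_before s hs', hz.before s hs'⟩
    · filter_upwards [hZf, hev] with κ hκ hlt s hs
      exact hκ.after s ⟨(not_lt.1 hlt).trans_lt ((le_max_left _ _).trans_lt hs.1),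
        hs.2.trans hz.mem.2⟩
    · filter_upwards [hZf, hev] with κ hκ hlt s hs
      exact hκ.after s ⟨((not_lt.1 hlt).trans_lt hb).trans hs.1, hs.2⟩
  · intro b hb
    by_contra hev
    rw [← Ultrafilter.eventually_not] at hev
    have hb' : t < min b pr.tf := lt_min hb hz.mem.2
    refine false_of_multiplier_limit Finset.subset_union_right hS.symm hD hΨ hg hμ
      (a := t) (b := min b pr.tf) (a' := pr.t0) (b' := t) hz.mem.1.le hb' (min_le_right _ _)
      le_rfl hz.mem.1 hz.mem.2.le ?_ ?_ hz.before ?_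
    · intro s hs
      have hs' : s ∈ Ioo t pr.tf := ⟨hs.1, hs.2.trans_le (min_le_right _ _)⟩
      exact ⟨hz.pmp_after s hs', hz.after s hs'⟩
    · filter_upwards [hZf, hev] with κ hκ hlt s hs
      exact hκ.before s ⟨hz.mem.1.trans hs.1,
        (hs.2.trans_le (min_le_left _ _)).trans_le (not_lt.1 hlt)⟩
    · filter_upwards [hZf, hev] with κ hκ hlt s hs
      exact hκ.before s ⟨hs.1, (hs.2.trans hb).trans_le (not_lt.1 hlt)⟩

theorem IsSwitchingTime.unique (hS : S₁ ≠ S₂)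
    (hD : LinearIndependent ℝ (fun i : {i // i ∈ S₁ ∪ S₂} => pr.D i.1))
    (h : pr.IsSwitchingTime S₁ S₂ x₀ t) (h' : pr.IsSwitchingTime S₁ S₂ x₀ t') : t = t' := by
  obtain ⟨z, hz⟩ := h
  obtain ⟨z', hz'⟩ := h'
  -- Stability applied to a constant family: the constant `t` converges to `t'`. No interior point
  -- is needed, as a single costate is bounded.
  have := hz'.tendsto_switchingTime (l := (pure () : Filter Unit)) hS hD (Z := fun _ => z)
    (X := fun _ => x₀) (τ := fun _ => t) (Eventually.of_forall fun _ => hz) tendsto_const_nhds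
    (K := ‖z.lam pr.t0‖) (Eventually.of_forall fun _ => le_rfl)
  exact tendsto_nhds_unique tendsto_const_nhds this

end LQProblem

theorem lemma1 {n k m p : ℕ} (pr : LQProblem n k m p)
    (S₁ S₂ : Finset (Fin m)) (hS : S₁ ≠ S₂)
    (hD : LinearIndependent ℝ (fun i : {i // i ∈ S₁ ∪ S₂} => pr.D i.1))
    (𝓡 : Set (Fin n → ℝ)) (h𝓡 : pr.IsCriticalRegion S₁ S₂ 𝓡) :
    ∃ ts : (Fin n → ℝ) → ℝ,
      (∀ x₀ ∈ 𝓡,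
        ts x₀ ∈ Ioo pr.t0 pr.tf ∧
        pr.IsSwitchingTime S₁ S₂ x₀ (ts x₀) ∧
        (∀ t, pr.IsSwitchingTime S₁ S₂ x₀ t → t = ts x₀) ∧
        (∀ (z : Trajectory n k m p) (t' : ℝ), pr.HasSwitch S₁ S₂ z x₀ t' →
          ∀ i ∈ symmDiff S₁ S₂, ∀ t ∈ Ioo pr.t0 pr.tf,
            pr.MultiplierReachesZero z i t ↔ t = ts x₀)) ∧
      ContinuousOn ts (interior 𝓡) := by
  have hne : Nonempty (Trajectory n k m p) := ⟨⟨0, 0, 0, 0, 0⟩⟩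
  have hex : ∀ x₀, ∃ (τ : ℝ) (z : Trajectory n k m p), x₀ ∈ 𝓡 → pr.HasSwitch S₁ S₂ z x₀ τ := by
    intro x₀
    by_cases hx : x₀ ∈ 𝓡
    · obtain ⟨t, z, hz⟩ := h𝓡 x₀ hx
      exact ⟨t, z, fun _ => hz⟩
    · exact ⟨0, hne.some, fun h => absurd h hx⟩
  choose ts Z hZ using hex
  refine ⟨ts, fun x₀ hx => ⟨(hZ x₀ hx).mem, ⟨Z x₀, hZ x₀ hx⟩,
    fun t ht => ht.unique hS hD ⟨Z x₀, hZ x₀ hx⟩, fun z t' hz i hi t ht => ?_⟩, fun x₀ hx => ?_⟩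
  · rw [hz.multiplierReachesZero_iff hD hi ht,
      LQProblem.IsSwitchingTime.unique hS hD ⟨z, hz⟩ ⟨Z x₀, hZ x₀ hx⟩]
  -- Only here does interiority matter: the bound for monotone maps needs extremals at all nearby
  -- initial states.
  · have hnhds : 𝓡 ∈ 𝓝 x₀ := mem_interior_iff_mem_nhds.1 hx
    obtain ⟨K, hK⟩ := exists_eventually_norm_le_of_monotone
      (T := fun x => (Z x).lam pr.t0) hnhds
      (fun a ha b hb => (hZ a ha).extremal.monotone_costate (hZ b hb).extremal)
    have : ContinuousAt ts x₀ := (hZ x₀ (interior_subset hx)).tendsto_switchingTime hS hD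
      (X := id) (Filter.mem_of_superset hnhds fun x hx' => hZ x hx') tendsto_id hK
    exact this.continuousWithinAt
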